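/- **Setting.** Let $k\ge 1$ be an integer and let $b\in\mathbb C$ with $|b|=1$, $\mathrm{Re}\,b>0$, $\mathrm{Im}\,b\ne0$. Put $Q=b+b^{-1}>0$, $q=e^{\frac{2\pi i}{k}(1+b^2)}$, $\tilde q=e^{\frac{2\pi i}{k}(1+b^{-2})}$. *Quantum dilogarithm.* For $\mu\in\mathbb C$, $m\in\mathbb Z/k\mathbb Z$ let $z=e^{\frac{2\pi i}{k}(-ib\mu-m)}$, $\tilde z=e^{\frac{2\pi i}{k}(-ib^{-1}\mu+m)}$, and let $\Psi_\Delta(\mu|m)$ be the meromorphic function of $\mu$ given by $\prod_{j\ge0}\frac{1-q^{j+1}z^{-1}}{1-\tilde q^{-j}\tilde z^{-1}}$ if $|q|<1$, and by $\prod_{j\ge0}\frac{1-\tilde q^{j+1}\tilde z^{-1}}{1-q^{-j}z^{-1}}$ if $|q|>1$. *Octahedron.* Let $$Z_{\rm oct}(\mu_X,\mu_Y,\mu_Z|m_X,m_Y,m_Z)=\Psi_\Delta(\mu_X|m_X)\Psi_\Delta(\mu_Y|m_Y)\Psi_\Delta(\mu_Z|m_Z)\Psi_\Delta(iQ-\mu_X-\mu_Y-\mu_Z|-m_X-m_Y-m_Z),$$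 and let $\mathfrak P({\rm oct})\subset\mathbb R^3\times\mathbb R^3$ be the open polytope of all $(\alpha,\beta)$ such that, for all $i\ne j$ in $\{X,Y,Z\}$ and with $|\alpha|=\alpha_X+\alpha_Y+\alpha_Z$, $$\alpha_i>0,\quad |\alpha|<Q,\quad \alpha_i+\beta_i<\tfrac Q2,\quad |\alpha|+\beta_i>\tfrac Q2,\quad \alpha_j+\beta_j-\beta_i<\tfrac Q2 .$$ *Gluing data.* Let $\Phi=(X_a,Y_a,Z_a)_{a=1}^5$ and $\Pi=(P_{X_a},P_{Y_a},P_{Z_a})_{a=1}^5$, and let $\mathbf A,\mathbf B$ be the integer $15\times15$ matrices for which $\mathscr Q=\mathbf A\Phi+\mathbf B\Pi$ is the list $$\begin{aligned} \mathscr Q_{12}&=X_3+Y_3+X_4+Y_4+X_5+Y_5+P_{Y_3}+P_{Y_4}+P_{Y_5},\\ \mathscr Q_{13}&=X_2+Y_2+X_5+Y_5+2Z_5+P_{Y_2}+P_{Y_4}-P_{Z_4}+P_{Z_5},\\ \mathscr Q_{14}&=X_3+Y_3+2Z_3+P_{Y_2}-P_{Z_2}+P_{Z_3}+P_{Y_5}-P_{Z_5},\\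 \mathscr Q_{15}&=X_2+Y_2+2Z_2+X_4+Y_4+2Z_4+P_{Z_2}+P_{Y_3}-P_{Z_3}+P_{Z_4},\\ \mathscr Q_{23}&=X_4-Y_4-P_{X_1}+P_{X_4}-P_{Y_4}-P_{X_5},\\ \mathscr Q_{24}&=-X_1-Y_1+X_5-Y_5-P_{Y_1}-P_{X_3}+P_{X_5}-P_{Y_5},\\ \mathscr Q_{25}&=X_1-Y_1+X_3-Y_3+P_{X_1}-P_{Y_1}+P_{X_3}-P_{Y_3}-P_{X_4},\\ \mathscr Q_{34}&=-X_1-Y_1-2Z_1+X_2-Y_2+X_5+Y_5-P_{Z_1}+P_{X_2}-P_{Y_2}+P_{X_5}-P_{Z_5},\\ \mathscr Q_{35}&=X_1+Y_1-X_4-Y_4+P_{X_1}-P_{Z_1}-P_{X_2}-P_{X_4}+P_{Z_4},\\ \mathscr Q_{45}&=-X_2-Y_2+X_3+Y_3+P_{Y_1}-P_{Z_1}-P_{X_2}+P_{Z_2}+P_{X_3}-P_{Z_3},\\ \mathscr Q_{1}&=-Z_2+Z_5+P_{Y_2}-P_{Z_2},\\ \mathscr Q_{2}&=-X_1+X_5-P_{X_1},\\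 \mathscr Q_{3}&=-X_1-Y_1-Z_1+X_5+Y_5+Z_5+P_{X_5},\\ \mathscr Q_{4}&=X_1+Y_1+Z_1-X_5+P_{Z_1}-P_{X_5}+P_{Y_5},\\ \mathscr Q_{5}&=-X_1+X_4+Y_4+Z_4-P_{X_1}+P_{Y_1}+P_{X_4}. \end{aligned}$$ The first ten coordinates belong to the annuli $ab$, the last five to the four-holed spheres $a$. Here $\mathbf A\mathbf B^T$ is symmetric and $\det(-\mathbf B)=-16$. Let $\vec t=(-3,-3,-2,-4,0,1,0,1,0,0,1,1,1,0,0)^T$. *Partition function of $S^3\setminus\Gamma_5$.* For $\mu\in\mathbb C^{15}$ and $m\in(\mathbb Z/k\mathbb Z)^{15}$ let $Z_\times(\mu|m)$ be the product of the five octahedron functions $Z_{\rm oct}(\mu_{X_a},\mu_{Y_a},\mu_{Z_a}|m_{X_a},m_{Y_a},m_{Z_a})$ and put $$Z_1(\mu|m)=\sqrt{\det(-\mathbf B)}\,Z_\times(-\mathbf B^T\mu|-\mathbf B^Tm),$$ $$Z_2(\mu|m)=(-1)^{m\cdot \mathbf A\mathbf B^Tm}e^{\frac{i\pi}{k}(-\mu\cdot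 \mathbf A\mathbf B^T\mu+m\cdot \mathbf A\mathbf B^Tm)}Z_1(\mu|m),$$ $$Z_3(\mu|m)=\frac1{k^{15}}\sum_{n\in(\mathbb Z/k)^{15}}\int_{\mathrm{Im}\,\nu=\beta}d^{15}\nu\;e^{\frac{2\pi i}{k}(-\mu\cdot\nu+m\cdot n)}Z_2(\nu|n),$$ $$\mathcal Z_{S^3\setminus\Gamma_5}(\mu|m)=Z_3(\mu-\tfrac{iQ}2\vec t\,|m).$$ Let $\mathfrak P_{\rm new}\subset\mathbb R^{15}\times\mathbb R^{15}$ be the image of $\mathfrak P({\rm oct})^{\times5}$ under the successive maps $(\alpha,\beta)\mapsto(-(\mathbf B^{-1})^T\alpha,-\mathbf B\beta)$, $(\alpha,\beta)\mapsto(\alpha,\mathbf A\mathbf B^T\alpha+\beta)$, $(\alpha,\beta)\mapsto(-\beta,\alpha)$, $(\alpha,\beta)\mapsto(\alpha+\frac Q2\vec t,\beta)$. *Coherent states.* For $z\in\mathbb C$, $x,y\in[0,2\pi)$ and $\beta\in\mathbb R$ let $$\psi_z(\mu)=e^{-\sqrt2\,\beta\,\mathrm{Re}(z)}\left(\tfrac2k\right)^{1/4}e^{-\frac\pi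 k\left(\mu-\frac{k}{\pi\sqrt2}\mathrm{Re}(z)\right)^2}e^{i\sqrt2\,\mu\,\mathrm{Im}(z)}\qquad(\mu\in\mathbb R),$$ $$\xi_{(x,y)}(m)=\left(\tfrac2k\right)^{1/4}e^{-\frac{ikxy}{4\pi}}\sum_{n\in\mathbb Z}e^{-\frac k{4\pi}\left(\frac{2\pi m}k-2\pi n-x\right)^2}e^{-\frac{ik}{2\pi}y\left(\frac{2\pi m}k-2\pi n-x\right)}\qquad(m\in\mathbb Z/k\mathbb Z),$$ and for $\rho=\{z_a,x_a,y_a\}_{a=1}^5$ let $\Psi_\rho(\{\mu_a\}|\{m_a\})=\prod_{a=1}^5\psi_{z_a}(\mu_a)\,\xi_{(x_a,y_a)}(m_a)$, where $\psi_{z_a}$ is formed with the sphere component $\beta_a$ of $\beta\in\mathbb R^{15}$. **Theorem.** The polytope $\mathfrak P_{\rm new}$ is non-empty. Let $(\alpha,\beta)\in\mathfrak P_{\rm new}$. Then: 1. for every $\mu\in\mathbb C^{15}$ with $\mathrm{Im}\,\mu=\alpha$ and every $m$, the integrals that define $\mathcal Z_{S^3\setminus\Gamma_5}(\mu|m)$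 on the contour $\mathrm{Im}\,\nu=\beta$ converge absolutely, and the value is the same for every $\beta'$ with $(\alpha,\beta')\in\mathfrak P_{\rm new}$; 2. for all annulus data $\{\mu_{ab}\}_{a<b}\in\mathbb R^{10}$, $\{m_{ab}\}_{a<b}\in(\mathbb Z/k\mathbb Z)^{10}$, the integrals in $$\mathcal Z(\rho)=\sum_{\{m_a\}\in(\mathbb Z/k\mathbb Z)^5}\int_{\mathbb R^5}\prod_{a=1}^5d\mu_a\;\mathcal Z_{S^3\setminus\Gamma_5}(\vec\mu+i\alpha\,|\,\vec m)\,\Psi_\rho(\{\mu_a\}|\{m_a\}),\qquad \vec\mu=(\{\mu_{ab}\},\{\mu_a\}),\quad \vec m=(\{m_{ab}\},\{m_a\}),$$ converge absolutely, and there is a constant $C$ (depending on $k,b,\alpha,\beta$ and the annulus data) such that $|\mathcal Z(\rho)|\le C$ for all $\rho=\{z_a,x_a,y_a\}_{a=1}^5$ with $z_a\in\mathbb C$ and $x_a,y_a\in[0,2\pi)$. -/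

import Mathlib

noncomputable section

namespace GammaFive

open Complex Filter Topology

/-! ## The quantum dilogarithm at level `k` -/

/-- `Q = b + b⁻¹`, a real number when `|b| = 1`. -/
def Qb (b : ℂ) : ℝ := (b + b⁻¹).re

def qPar (k : ℕ) (b : ℂ) : ℂ := exp (2 * Real.pi * I / k * (1 + b ^ 2))

def qParTilde (k : ℕ) (b : ℂ) : ℂ := exp (2 * Real.pi * I / k * (1 + (b ^ 2)⁻¹))

/-- `z` as a function of `(μ, m)`; it depends on `m` only modulo `k`. -/
def zVar (k : ℕ) (b μ : ℂ) (m : ZMod k) : ℂ :=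
  exp (2 * Real.pi * I / k * (-I * b * μ - (m.val : ℂ)))

def zVarTilde (k : ℕ) (b μ : ℂ) (m : ZMod k) : ℂ :=
  exp (2 * Real.pi * I / k * (-I * b⁻¹ * μ + (m.val : ℂ)))

/-- The product formula of the quantum dilogarithm, valid off the zeros of the denominators. -/
def dilogProduct (k : ℕ) (b μ : ℂ) (m : ZMod k) : ℂ :=
  if ‖qPar k b‖ < 1 then
    ∏' j : ℕ, (1 - qPar k b ^ (j + 1) * (zVar k b μ m)⁻¹) /
      (1 - ((qParTilde k b)⁻¹) ^ j * (zVarTilde k b μ m)⁻¹)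
  else
    ∏' j : ℕ, (1 - qParTilde k b ^ (j + 1) * (zVarTilde k b μ m)⁻¹) /
      (1 - ((qPar k b)⁻¹) ^ j * (zVar k b μ m)⁻¹)

/-- The quantum dilogarithm `Ψ_Δ(μ | m)`: the meromorphic function of `μ` given by the product
formula. Some zeros of the denominators are cancelled by zeros of the numerators; the limit over
the punctured neighbourhood gives the value of the meromorphic function there as well. -/
def quantumDilog (k : ℕ) (b μ : ℂ) (m : ZMod k) : ℂ :=
  limUnder (𝓝[≠] μ) (fun w => dilogProduct k b w m)

/-! ## The octahedron -/

/-- `Z_oct(μ_X, μ_Y, μ_Z | m_X, m_Y, m_Z)`. -/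
def Zoct (k : ℕ) (b : ℂ) (μ : Fin 3 → ℂ) (m : Fin 3 → ZMod k) : ℂ :=
  quantumDilog k b (μ 0) (m 0) * quantumDilog k b (μ 1) (m 1) * quantumDilog k b (μ 2) (m 2) *
    quantumDilog k b (I * (Qb b : ℂ) - μ 0 - μ 1 - μ 2) (-m 0 - m 1 - m 2)

/-- Positive angle structures `(α, β)` of the octahedron. The inequalities without `β` put all
four dilogarithm arguments into the upper half-plane. The three remaining families say that
`exp (-(2π/k) β · μ) Z_oct (μ + i α)` decays along the rays `-e_i`, `e_i` and `e_i - e_j`, the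
extremal rays of the fan cut out by `μ_X = 0`, `μ_Y = 0`, `μ_Z = 0` and `μ_X + μ_Y + μ_Z = 0`. -/
def octPolytope (b : ℂ) : Set ((Fin 3 → ℝ) × (Fin 3 → ℝ)) :=
  {p | (∀ i, 0 < p.1 i) ∧ (∑ i, p.1 i) < Qb b ∧
    (∀ i, p.1 i + p.2 i < Qb b / 2) ∧
    (∀ i, Qb b / 2 < (∑ j, p.1 j) + p.2 i) ∧
    (∀ i j, i ≠ j → p.1 j + p.2 j - p.2 i < Qb b / 2)}

/-! ## The symplectic data of the gluing

Positions and momenta of the five octahedra are ordered as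
`(X₁, Y₁, Z₁, X₂, Y₂, Z₂, …, X₅, Y₅, Z₅)`. The new coordinates are ordered as the ten annuli
`12, 13, 14, 15, 23, 24, 25, 34, 35, 45` followed by the five four-holed spheres `1, …, 5`. -/

/-- Index of coordinate `i` (`X`, `Y` or `Z`) of octahedron `a`. -/
def octIdx (a : Fin 5) (i : Fin 3) : Fin 15 := ⟨3 * a.val + i.val, by omega⟩

/-- Index of the four-holed sphere `a`. -/
def sphereIdx (a : Fin 5) : Fin 15 := Fin.natAdd 10 a

def matA : Matrix (Fin 15) (Fin 15) ℤ :=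
  !![0, 0, 0, 0, 0, 0, 1, 1, 0, 1, 1, 0, 1, 1, 0;
     0, 0, 0, 1, 1, 0, 0, 0, 0, 0, 0, 0, 1, 1, 2;
     0, 0, 0, 0, 0, 0, 1, 1, 2, 0, 0, 0, 0, 0, 0;
     0, 0, 0, 1, 1, 2, 0, 0, 0, 1, 1, 2, 0, 0, 0;
     0, 0, 0, 0, 0, 0, 0, 0, 0, 1, -1, 0, 0, 0, 0;
     -1, -1, 0, 0, 0, 0, 0, 0, 0, 0, 0, 0, 1, -1, 0;
     1, -1, 0, 0, 0, 0, 1, -1, 0, 0, 0, 0, 0, 0, 0;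
     -1, -1, -2, 1, -1, 0, 0, 0, 0, 0, 0, 0, 1, 1, 0;
     1, 1, 0, 0, 0, 0, 0, 0, 0, -1, -1, 0, 0, 0, 0;
     0, 0, 0, -1, -1, 0, 1, 1, 0, 0, 0, 0, 0, 0, 0;
     0, 0, 0, 0, 0, -1, 0, 0, 0, 0, 0, 0, 0, 0, 1;
     -1, 0, 0, 0, 0, 0, 0, 0, 0, 0, 0, 0, 1, 0, 0;
     -1, -1, -1, 0, 0, 0, 0, 0, 0, 0, 0, 0, 1, 1, 1;
     1, 1, 1, 0, 0, 0, 0, 0, 0, 0, 0, 0, -1, 0, 0;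
     -1, 0, 0, 0, 0, 0, 0, 0, 0, 1, 1, 1, 0, 0, 0]

def matB : Matrix (Fin 15) (Fin 15) ℤ :=
  !![0, 0, 0, 0, 0, 0, 0, 1, 0, 0, 1, 0, 0, 1, 0;
     0, 0, 0, 0, 1, 0, 0, 0, 0, 0, 1, -1, 0, 0, 1;
     0, 0, 0, 0, 1, -1, 0, 0, 1, 0, 0, 0, 0, 1, -1;
     0, 0, 0, 0, 0, 1, 0, 1, -1, 0, 0, 1, 0, 0, 0;
     -1, 0, 0, 0, 0, 0, 0, 0, 0, 1, -1, 0, -1, 0, 0;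
     0, -1, 0, 0, 0, 0, -1, 0, 0, 0, 0, 0, 1, -1, 0;
     1, -1, 0, 0, 0, 0, 1, -1, 0, -1, 0, 0, 0, 0, 0;
     0, 0, -1, 1, -1, 0, 0, 0, 0, 0, 0, 0, 1, 0, -1;
     1, 0, -1, -1, 0, 0, 0, 0, 0, -1, 0, 1, 0, 0, 0;
     0, 1, -1, -1, 0, 1, 1, 0, -1, 0, 0, 0, 0, 0, 0;
     0, 0, 0, 0, 1, -1, 0, 0, 0, 0, 0, 0, 0, 0, 0;
     -1, 0, 0, 0, 0, 0, 0, 0, 0, 0, 0, 0, 0, 0, 0;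
     0, 0, 0, 0, 0, 0, 0, 0, 0, 0, 0, 0, 1, 0, 0;
     0, 0, 1, 0, 0, 0, 0, 0, 0, 0, 0, 0, -1, 1, 0;
     -1, 1, 0, 0, 0, 0, 0, 0, 0, 1, 0, 0, 0, 0, 0]

def vecT : Fin 15 → ℤ := ![-3, -3, -2, -4, 0, 1, 0, 1, 0, 0, 1, 1, 1, 0, 0]

/-- The symmetric integer matrix `A Bᵀ`. -/
def matABt : Matrix (Fin 15) (Fin 15) ℤ := matA * matB.transpose

/-! ## Angle structures -/

/-- Pairs `(α, β)` of a vector of position angles and a vector of momentum angles. -/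
abbrev AngleSpace : Type := (Fin 15 → ℝ) × (Fin 15 → ℝ)

/-- The product of five octahedron polytopes. -/
def polytopeFiveOct (b : ℂ) : Set AngleSpace :=
  {p | ∀ a : Fin 5, ((fun i => p.1 (octIdx a i)), (fun i => p.2 (octIdx a i))) ∈ octPolytope b}

def angleU (p : AngleSpace) : AngleSpace :=
  ((-((matB.map (Int.cast : ℤ → ℝ))⁻¹).transpose).mulVec p.1,
    (-(matB.map (Int.cast : ℤ → ℝ))).mulVec p.2)

def angleT (p : AngleSpace) : AngleSpace :=
  (p.1, (matABt.map (Int.cast : ℤ → ℝ)).mulVec p.1 + p.2)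

def angleS (p : AngleSpace) : AngleSpace := (-p.2, p.1)

def angleShift (b : ℂ) (p : AngleSpace) : AngleSpace :=
  (fun i => p.1 i + Qb b / 2 * (vecT i : ℝ), p.2)

/-- The polytope of positive angle structures of `S³ ∖ Γ₅`. -/
def polytopeNew (b : ℂ) : Set AngleSpace :=
  (fun p => angleShift b (angleS (angleT (angleU p)))) '' polytopeFiveOct b

/-! ## The partition function of `S³ ∖ Γ₅` -/

/-- Functions of `(μ | m)` with `μ ∈ ℂ¹⁵` and `m ∈ (ℤ/k)¹⁵`. -/
abbrev WaveFn (k : ℕ) : Type := (Fin 15 → ℂ) → (Fin 15 → ZMod k) → ℂ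

/-- The product of the five octahedron partition functions. -/
def Zprod (k : ℕ) (b : ℂ) : WaveFn k := fun μ m =>
  ∏ a : Fin 5, Zoct k b (fun i => μ (octIdx a i)) (fun i => m (octIdx a i))

/-- `U`-type transformation; `det (-B) = -16`, and the square root is `4 i`. -/
def actU {k : ℕ} (f : WaveFn k) : WaveFn k := fun μ m =>
  (((-matB).det : ℤ) : ℂ) ^ (1 / 2 : ℂ) *
    f ((-(matB.map (Int.cast : ℤ → ℂ)).transpose).mulVec μ)
      ((-(matB.map (Int.cast : ℤ → ZMod k)).transpose).mulVec m)

/-- `m · A Bᵀ · m` for the representatives of `m` in `{0, …, k - 1}`. -/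
def quadABt {k : ℕ} (m : Fin 15 → ZMod k) : ℤ :=
  dotProduct (fun i => ((m i).val : ℤ)) (matABt.mulVec (fun i => ((m i).val : ℤ)))

/-- `T`-type transformation; the factor depends on the entries of `m` only modulo `k`. -/
def actT {k : ℕ} (f : WaveFn k) : WaveFn k := fun μ m =>
  (-1 : ℂ) ^ quadABt m *
    exp (I * Real.pi / k *
      (-(dotProduct μ ((matABt.map (Int.cast : ℤ → ℂ)).mulVec μ)) + (quadABt m : ℂ))) *
    f μ m

/-- The integrand of the `S`-type transformation on the contour `ν = x + i β`, `x ∈ ℝ¹⁵`. -/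
def integrandS {k : ℕ} (β : Fin 15 → ℝ) (f : WaveFn k) (μ : Fin 15 → ℂ) (m n : Fin 15 → ZMod k)
    (x : Fin 15 → ℝ) : ℂ :=
  exp (2 * Real.pi * I / k *
      (-(∑ i, μ i * ((x i : ℂ) + I * (β i : ℂ))) + ∑ i, ((m i).val : ℂ) * ((n i).val : ℂ))) *
    f (fun i => (x i : ℂ) + I * (β i : ℂ)) n

/-- `S`-type transformation with the contour `Im ν = β`. -/
def actS {k : ℕ} [NeZero k] (β : Fin 15 → ℝ) (f : WaveFn k) : WaveFn k := fun μ m =>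
  1 / (k : ℂ) ^ 15 * ∑ n : Fin 15 → ZMod k, ∫ x : Fin 15 → ℝ, integrandS β f μ m n x

/-- The argument `μ - (i Q / 2) t` of the affine shift. -/
def shiftArg (b : ℂ) (μ : Fin 15 → ℂ) : Fin 15 → ℂ :=
  fun i => μ i - I * (Qb b : ℂ) / 2 * (vecT i : ℂ)

/-- Affine shift. -/
def actShift {k : ℕ} (b : ℂ) (f : WaveFn k) : WaveFn k := fun μ m => f (shiftArg b μ) m

/-- `Z_{S³ ∖ Γ₅}(μ | m)`, computed with the contour `Im ν = β`. -/
def partitionFn (k : ℕ) [NeZero k] (b : ℂ) (β : Fin 15 → ℝ) : WaveFn k :=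
  actShift b (actS β (actT (actU (Zprod k b))))

/-- The point `x + i α` of `ℂ¹⁵`. -/
def complexPt (x α : Fin 15 → ℝ) : Fin 15 → ℂ := fun i => (x i : ℂ) + I * (α i : ℂ)

/-- The integrand of the state integral that defines `Z_{S³ ∖ Γ₅}(μ | m)`. -/
def stateIntegrand (k : ℕ) (b : ℂ) (β : Fin 15 → ℝ) (μ : Fin 15 → ℂ) (m n : Fin 15 → ZMod k)
    (x : Fin 15 → ℝ) : ℂ :=
  integrandS β (actT (actU (Zprod k b))) (shiftArg b μ) m n x

/-! ## Coherent states -/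

/-- The normalized coherent state `ψ⁰_z(μ)` of `L²(ℝ)`. -/
def coherentNormalized (k : ℕ) (z : ℂ) (μ : ℝ) : ℂ :=
  (((2 / k : ℝ) ^ (1 / 4 : ℝ) *
      Real.exp (-(Real.pi / k) * (μ - k / (Real.pi * √2) * z.re) ^ 2) : ℝ) : ℂ) *
    exp (I * (√2 * μ * z.im : ℝ))

/-- `ψ_z(μ)`, with the prefactor that depends on the momentum angle `β`. -/
def coherentPsi (k : ℕ) (β : ℝ) (z : ℂ) (μ : ℝ) : ℂ :=
  (Real.exp (-√2 * β * z.re) : ℂ) * coherentNormalized k z μ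

/-- The coherent state `ξ_{(x,y)}(m)` of `ℂᵏ`. -/
def coherentXi (k : ℕ) (x y : ℝ) (m : ZMod k) : ℂ :=
  (((2 / k : ℝ) ^ (1 / 4 : ℝ) : ℝ) : ℂ) * exp (-(I * k * x * y) / (4 * Real.pi)) *
    ∑' n : ℤ,
      exp (-(k / (4 * Real.pi)) * (2 * Real.pi * (m.val : ℂ) / k - 2 * Real.pi * n - x) ^ 2) *
      exp (-(I * k / (2 * Real.pi)) * y * (2 * Real.pi * (m.val : ℂ) / k - 2 * Real.pi * n - x))

/-- The product `Ψ_ρ` of the coherent states of the five four-holed spheres, `ρ = (z, x, y)`. -/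
def coherentProduct (k : ℕ) (β : Fin 15 → ℝ) (z : Fin 5 → ℂ) (x y : Fin 5 → ℝ)
    (μ : Fin 5 → ℝ) (m : Fin 5 → ZMod k) : ℂ :=
  ∏ a : Fin 5, coherentPsi k (β (sphereIdx a)) (z a) (μ a) * coherentXi k (x a) (y a) (m a)

/-! ## The pairing -/

/-- The integrand of the pairing, as a function of the real parts `μ` of the sphere positions. -/
def pairingIntegrand (k : ℕ) [NeZero k] (b : ℂ) (α β : Fin 15 → ℝ)
    (μann : Fin 10 → ℝ) (mann : Fin 10 → ZMod k) (z : Fin 5 → ℂ) (x y : Fin 5 → ℝ)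
    (m : Fin 5 → ZMod k) (μ : Fin 5 → ℝ) : ℂ :=
  partitionFn k b β (complexPt (Fin.append μann μ) α) (Fin.append mann m) *
    coherentProduct k β z x y μ m

/-- The partial pairing of `Z_{S³ ∖ Γ₅}` with `Ψ_ρ`. -/
def pairing (k : ℕ) [NeZero k] (b : ℂ) (α β : Fin 15 → ℝ)
    (μann : Fin 10 → ℝ) (mann : Fin 10 → ZMod k) (z : Fin 5 → ℂ) (x y : Fin 5 → ℝ) : ℂ :=
  ∑ m : Fin 5 → ZMod k, ∫ μ : Fin 5 → ℝ, pairingIntegrand k b α β μann mann z x y m μ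

end GammaFive

end

noncomputable section

namespace GammaFive

open Complex Filter Topology MeasureTheory

/-! ## The `q`-Pochhammer symbol -/

/-! The angle inequalities are exactly what makes the integrand decay exponentially, so the theorem
reduces to sharp growth bounds, uniform in closed strips.

One dilogarithm: on the upper half-plane every zero of the denominator is simple and cancelled by
the numerator, so `Ψ_Δ` is holomorphic there. Combining the shifts by `i b` and `i b⁻¹` gives the
real translation by `2 Im b`, under which `Ψ_Δ` is multiplied by an explicit ratio `(1 - u) / (1 -
v)`. Iterating it along a horizontal line, with geometrically summable errors, bounds `|Ψ_Δ(x + i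
a)|` by a constant times `exp ((2π/k) (a - Q/2) max(0, -x))` (`exists_norm_quantumDilog_le`).

One octahedron: four such bounds make `exp (-(2π/k) β · x) |Z_oct(x + i α)|` at most the exponential
of a piecewise linear function on a fan. The polytope says that this function is negative on the
extremal rays, hence it is at most a negative multiple of `∑ |xᵢ|` (`exists_norm_Zoct_le`).

Five octahedra: on a contour `Im ν = β` the Fourier kernel and the quadratic exponential have moduli
whose logarithms are affine in `Re ν`. The maps defining the new polytope are chosen so that these
moduli supply the damping of each octahedron (`norm_stateFn`). Invertibility of `B` turns this into
decay in all 15 variables, which gives absolute convergence; convexity of the angle conditions and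
Cauchy's theorem give independence of the contour.

Pairing: integration leaves `|Z(x + i α)| ≤ C exp ((2π/k) x · β)`. The prefactor of `ψ_z` is such
that this growth times `|ψ_z|` is a Gaussian whose height does not depend on `z`
(`norm_coherentPsi_mul`). Only its centre moves, and Lebesgue measure is translation invariant; the
`ξ` are bounded theta series. -/

/-- The infinite `q`-Pochhammer symbol `∏_{j ≥ 0} (1 - p ^ j w)`. -/
def qPoch (p w : ℂ) : ℂ := ∏' j : ℕ, (1 - p ^ j * w)

section qPoch

variable {p : ℂ}

lemma summable_norm_qPoch (hp : ‖p‖ < 1) (w : ℂ) : Summable fun j : ℕ => ‖-(p ^ j * w)‖ := by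
  simpa using (summable_geometric_of_lt_one (norm_nonneg p) hp).mul_right ‖w‖

lemma multipliable_qPoch (hp : ‖p‖ < 1) (w : ℂ) : Multipliable fun j : ℕ => 1 - p ^ j * w := by
  simpa [sub_eq_add_neg] using multipliable_one_add_of_summable (summable_norm_qPoch hp w)

lemma qPoch_step (hp : ‖p‖ < 1) (w : ℂ) : qPoch p w = (1 - w) * qPoch p (p * w) := by
  have h : Multipliable fun j : ℕ => 1 - p ^ (j + 1) * w := by
    simpa [pow_succ, mul_assoc] using multipliable_qPoch hp (p * w)
  have h2 := tprod_eq_zero_mul' (f := fun j : ℕ => 1 - p ^ j * w) h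
  rw [pow_zero, one_mul] at h2
  rw [qPoch, h2, qPoch]
  congr 2 with j
  rw [pow_succ, mul_assoc]

lemma qPoch_ne_zero (hp : ‖p‖ < 1) {w : ℂ} (h : ∀ j : ℕ, p ^ j * w ≠ 1) : qPoch p w ≠ 0 := by
  have := tprod_one_add_ne_zero_of_summable (f := fun j : ℕ => -(p ^ j * w)) (fun j => by
    rw [← sub_eq_add_neg, sub_ne_zero]; exact (h j).symm) (summable_norm_qPoch hp w)
  simpa [qPoch, sub_eq_add_neg] using this

lemma qPoch_eq_zero {w : ℂ} {j : ℕ} (h : p ^ j * w = 1) : qPoch p w = 0 :=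
  tprod_of_exists_eq_zero ⟨j, by rw [h, sub_self]⟩

lemma differentiable_qPoch (hp : ‖p‖ < 1) : Differentiable ℂ (qPoch p) := by
  intro w
  have hu : Summable fun j : ℕ => ‖p‖ ^ j * (‖w‖ + 1) :=
    (summable_geometric_of_lt_one (norm_nonneg p) hp).mul_right _
  have h := hu.hasProdLocallyUniformlyOn_nat_one_add (f := fun j x => -(p ^ j * x))
    (Metric.isOpen_ball (x := (0 : ℂ)) (ε := ‖w‖ + 1)) (.of_forall fun j x hx => by
      rw [norm_neg, norm_mul, norm_pow]
      have : ‖x‖ < ‖w‖ + 1 := by simpa using hx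
      gcongr) (fun j => by fun_prop)
  have h2 : DifferentiableOn ℂ (fun x => ∏' j : ℕ, (1 + -(p ^ j * x))) (Metric.ball 0 (‖w‖ + 1)) :=
    h.differentiableOn (.of_forall fun _ => by
      simpa [Finset.prod_fn] using DifferentiableOn.finsetProd (fun _ _ => by fun_prop))
        Metric.isOpen_ball
  have h3 := h2.differentiableAt (Metric.isOpen_ball.mem_nhds (by simp : w ∈ Metric.ball 0 (‖w‖ + 1)))
  have h4 : qPoch p = fun x => ∏' j : ℕ, (1 + -(p ^ j * x)) := by
    ext x
    simp only [qPoch, sub_eq_add_neg]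
  rw [h4]
  exact h3

/-- Differentiate `(1 - w) qPoch p (p w)`. At `w = 1` only the term `-qPoch p p ≠ 0` survives; at
the other zeros the first term vanishes and the second reduces to the zero at `p w`. Since `|p| <
1`, no positive power of `p` is `1`, so the zeros do not collide. -/
lemma deriv_qPoch_ne_zero (hp : ‖p‖ < 1) (j : ℕ) {w : ℂ} (h : p ^ j * w = 1) :
    deriv (qPoch p) w ≠ 0 := by
  have hd : ∀ w, HasDerivAt (qPoch p)
      (-1 * qPoch p (p * w) + (1 - w) * (deriv (qPoch p) (p * w) * p)) w := by
    intro w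
    have h1 : HasDerivAt (fun w : ℂ => 1 - w) (-1) w := by
      simpa using (hasDerivAt_id w).const_sub 1
    have h2 : HasDerivAt (fun w : ℂ => p * w) p w := by
      simpa using (hasDerivAt_id w).const_mul p
    have h3 : HasDerivAt (fun w => qPoch p (p * w)) (deriv (qPoch p) (p * w) * p) w :=
      (differentiable_qPoch hp (p * w)).hasDerivAt.comp w h2
    exact (h1.mul h3).congr_of_eventuallyEq (.of_forall (qPoch_step hp))
  have hlt : ∀ i : ℕ, p ^ (i + 1) ≠ 1 := fun i hi => by
    have h1 : ‖p‖ ^ (i + 1) < 1 := pow_lt_one₀ (norm_nonneg p) hp (by omega)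
    rw [← norm_pow, hi, norm_one] at h1
    exact lt_irrefl _ h1
  induction j generalizing w with
  | zero =>
    have hw : w = 1 := by simpa using h
    subst hw
    rw [(hd 1).deriv]
    have : qPoch p (p * 1) ≠ 0 := qPoch_ne_zero hp fun j => by
      simpa [← pow_succ] using hlt j
    simpa using this
  | succ j ih =>
    have h' : p ^ j * (p * w) = 1 := by rw [← h]; ring
    rw [(hd w).deriv, qPoch_eq_zero h']
    have hw : 1 - w ≠ 0 := by
      intro hw
      have : w = 1 := by linear_combination -hw
      subst this
      exact hlt j (by simpa using h)
    have hp0 : p ≠ 0 := by rintro rfl; simp at h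
    simpa using ⟨hw, ih h', hp0⟩

end qPoch

/-! ## Limits over punctured neighbourhoods -/

/-- Taking the limit pointwise fills the removable singularity at `z` and changes nothing at nearby
points. This identifies the limit in the definition of the dilogarithm with a holomorphic function.
-/
lemma limUnder_punctured_eventuallyEq {f g : ℂ → ℂ} {z : ℂ} (hg : AnalyticAt ℂ g z)
    (hfg : f =ᶠ[𝓝[≠] z] g) : (fun w => limUnder (𝓝[≠] w) f) =ᶠ[𝓝 z] g := by
  have key : ∀ w, ContinuousAt g w → f =ᶠ[𝓝[≠] w] g → limUnder (𝓝[≠] w) f = g w :=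
    fun w hw h => ((hw.tendsto.mono_left nhdsWithin_le_nhds).congr' h.symm).limUnder_eq
  have h1 := eventually_eventually_nhds.2 (eventually_nhdsWithin_iff.1 hfg)
  filter_upwards [h1, hg.eventually_analyticAt] with w hw hgw
  exact key w hgw.continuousAt <| by
    by_cases hwz : w = z
    · rw [hwz]; exact hfg
    · filter_upwards [nhdsWithin_le_nhds hw, nhdsWithin_le_nhds (isOpen_ne.mem_nhds hwz)]
        with v hv hvz using hv hvz

/-- A quotient of functions with a simple zero of the denominator that is cancelled by a zero of
the numerator. -/
lemma exists_analyticAt_eq_div {f g : ℂ → ℂ} {z : ℂ} (hf : Differentiable ℂ f)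
    (hg : Differentiable ℂ g) (h : g z = 0 → f z = 0 ∧ deriv g z ≠ 0) :
    (∀ᶠ w in 𝓝[≠] z, g w ≠ 0) ∧
      ∃ F : ℂ → ℂ, AnalyticAt ℂ F z ∧ (fun w => f w / g w) =ᶠ[𝓝[≠] z] F := by
  have ana : ∀ {u : ℂ → ℂ}, Differentiable ℂ u → ∀ w, AnalyticAt ℂ u w := fun hu w =>
    hu.analyticAt w
  by_cases hz : g z = 0
  · obtain ⟨h1, h2⟩ := h hz
    have hds : ∀ {u : ℂ → ℂ}, Differentiable ℂ u → Differentiable ℂ (dslope u z) := by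
      intro u hu
      rw [← differentiableOn_univ] at hu ⊢
      exact (differentiableOn_dslope univ_mem).2 hu
    refine ⟨?_, fun w => dslope f z w / dslope g z w, ?_, ?_⟩
    · have := (hg z).hasDerivAt.eventually_ne (c := 0) h2
      simpa using this
    · exact (ana (hds hf) z).div (ana (hds hg) z) (by rwa [dslope_same])
    · filter_upwards [self_mem_nhdsWithin] with w hw
      have hw' : w - z ≠ 0 := sub_ne_zero.2 hw
      have e1 : f w = (w - z) * dslope f z w := by
        simpa [h1] using (sub_smul_dslope f z w).symm
      have e2 : g w = (w - z) * dslope g z w := by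
        simpa [hz] using (sub_smul_dslope g z w).symm
      rw [e1, e2, mul_div_mul_left _ _ hw']
  · exact ⟨nhdsWithin_le_nhds ((hg z).continuousAt.eventually_ne hz), _,
      (ana hf z).div (ana hg z) hz, .rfl⟩

/-! ## The quantum dilogarithm as a holomorphic function on the upper half-plane -/

/-- The variable `z⁻¹` of the quantum dilogarithm, for an integer `n`. -/
def dilogVar (k : ℕ) (b : ℂ) (n : ℤ) (μ : ℂ) : ℂ :=
  exp (-(2 * Real.pi * I / k) * (-I * b * μ - n))

/-- For `0 < Im b` the bases `q` here and `q̃⁻¹` in the denominator both have modulus less than one.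
The integer `n` replaces a residue so that it can be shifted freely. -/
def dilogNum (k : ℕ) (b : ℂ) (n : ℤ) (μ : ℂ) : ℂ :=
  qPoch (qPar k b) (qPar k b * dilogVar k b n μ)

def dilogDen (k : ℕ) (b : ℂ) (n : ℤ) (μ : ℂ) : ℂ :=
  qPoch (qPar k b⁻¹)⁻¹ (dilogVar k b⁻¹ (-n) μ)

/-- The quantum dilogarithm for an integer `n`, in the case `Im b > 0`. -/
def dilogFn (k : ℕ) (b : ℂ) (n : ℤ) (μ : ℂ) : ℂ :=
  limUnder (𝓝[≠] μ) fun w => dilogNum k b n w / dilogDen k b n w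

lemma inv_eq_conj {b : ℂ} (hb : ‖b‖ = 1) : b⁻¹ = (starRingEnd ℂ) b := by
  rw [inv_def, normSq_eq_norm_sq, hb]; simp

lemma inv_re_of_norm {b : ℂ} (hb : ‖b‖ = 1) : b⁻¹.re = b.re := by simp [inv_eq_conj hb]

lemma inv_im_of_norm {b : ℂ} (hb : ‖b‖ = 1) : b⁻¹.im = -b.im := by simp [inv_eq_conj hb]

lemma Qb_eq {b : ℂ} (hb : ‖b‖ = 1) : Qb b = 2 * b.re := by
  rw [Qb, add_re, inv_re_of_norm hb]; ring

lemma norm_exp_mul_two_pi_I_div (k : ℕ) (w : ℂ) :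
    ‖exp (2 * Real.pi * I / k * w)‖ = Real.exp (-(2 * Real.pi / k) * w.im) := by
  rw [norm_exp]
  congr 1
  have : (2 * Real.pi * I / k : ℂ) = ((2 * Real.pi / k : ℝ) : ℂ) * I := by push_cast; ring
  rw [this, mul_assoc, re_ofReal_mul]
  simp

lemma norm_qPar (k : ℕ) (b : ℂ) :
    ‖qPar k b‖ = Real.exp (-(2 * Real.pi / k) * (2 * b.re * b.im)) := by
  rw [qPar, norm_exp_mul_two_pi_I_div]
  congr 2
  simp [sq]
  ring

lemma norm_dilogVar (k : ℕ) (b : ℂ) (n : ℤ) (μ : ℂ) :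
    ‖dilogVar k b n μ‖ = Real.exp (-(2 * Real.pi / k) * (b * μ).re) := by
  rw [dilogVar, neg_mul, ← mul_neg, norm_exp_mul_two_pi_I_div]
  congr 2
  simp
  ring

lemma differentiable_dilogVar (k : ℕ) (b : ℂ) (n : ℤ) : Differentiable ℂ (dilogVar k b n) := by
  unfold dilogVar; fun_prop

lemma exp_two_pi_I_div_nat_mul {k : ℕ} [NeZero k] {w w' : ℂ} {N : ℤ} (h : w = w' + k * N) :
    exp (2 * Real.pi * I / k * w) = exp (2 * Real.pi * I / k * w') := by
  have hk : (k : ℂ) ≠ 0 := NeZero.ne _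
  rw [exp_eq_exp_iff_exists_int]
  exact ⟨N, by rw [h]; field_simp⟩

lemma dilogVar_add_mul {k : ℕ} [NeZero k] (b : ℂ) (n N : ℤ) (μ : ℂ) :
    dilogVar k b (n + k * N) μ = dilogVar k b n μ := by
  have h : ∀ n : ℤ, dilogVar k b n μ = exp (2 * Real.pi * I / k * (I * b * μ + n)) := fun n => by
    rw [dilogVar]; congr 1; ring
  rw [h, h]
  exact exp_two_pi_I_div_nat_mul (k := k) (N := N) (by push_cast; ring)

lemma dilogFn_add_mul {k : ℕ} [NeZero k] (b : ℂ) (n N : ℤ) : dilogFn k b (n + k * N) = dilogFn k b n := by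
  ext μ
  simp only [dilogFn, dilogNum, dilogDen, dilogVar_add_mul,
    show -(n + k * N) = -n + k * (-N) by ring]

/-- Since `2 Im b = i (b⁻¹ - b)`, this real translation adds `b² - 1` to `-i b μ - n`; replacing `n`
by `n - 2` raises this to `b² + 1`, the exponent of `q`. -/
lemma dilogVar_shift {k : ℕ} {b : ℂ} (hb : ‖b‖ = 1) (n : ℤ) (μ : ℂ) :
    qPar k b * dilogVar k b (n - 2) (μ - 2 * (b.im : ℂ)) = dilogVar k b n μ := by
  have hb0 : b ≠ 0 := by rintro rfl; simp at hb
  have h2 : 2 * (b.im : ℂ) * I = b - b⁻¹ := by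
    rw [inv_eq_conj hb, sub_conj]; push_cast; ring
  rw [qPar, dilogVar, dilogVar, ← exp_add]
  congr 1
  have : (2 * (b.im : ℂ) * I) * b = b ^ 2 - 1 := by rw [h2]; field_simp
  push_cast
  linear_combination (-(2 * Real.pi * I / k : ℂ)) * this

lemma dilogVar_inv_shift {k : ℕ} {b : ℂ} (hb : ‖b‖ = 1) (n : ℤ) (μ : ℂ) :
    dilogVar k b⁻¹ (-(n - 2)) (μ - 2 * (b.im : ℂ)) = qPar k b⁻¹ * dilogVar k b⁻¹ (-n) μ := by
  have hb0 : b ≠ 0 := by rintro rfl; simp at hb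
  have h2 : 2 * (b.im : ℂ) * I = b - b⁻¹ := by
    rw [inv_eq_conj hb, sub_conj]; push_cast; ring
  rw [qPar, dilogVar, dilogVar, ← exp_add]
  congr 1
  have : (2 * (b.im : ℂ) * I) * b⁻¹ = 1 - b⁻¹ ^ 2 := by rw [h2]; field_simp
  push_cast
  linear_combination (-(2 * Real.pi * I / k : ℂ)) * this

section

variable {k : ℕ} [NeZero k] {b : ℂ}

lemma two_pi_div_pos (k : ℕ) [NeZero k] : 0 < 2 * Real.pi / k :=
  div_pos (by positivity) (by exact_mod_cast Nat.pos_of_ne_zero (NeZero.ne k))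

lemma norm_qPar_lt_one (hre : 0 < b.re) (him : 0 < b.im) : ‖qPar k b‖ < 1 := by
  rw [norm_qPar, Real.exp_lt_one_iff]
  have := two_pi_div_pos k
  have : 0 < 2 * Real.pi / k * (2 * b.re * b.im) := by positivity
  linarith

lemma norm_qPar_inv_lt_one (hb : ‖b‖ = 1) (hre : 0 < b.re) (him : 0 < b.im) :
    ‖(qPar k b⁻¹)⁻¹‖ < 1 := by
  rw [norm_inv, norm_qPar, ← Real.exp_neg, Real.exp_lt_one_iff, inv_re_of_norm hb, inv_im_of_norm hb]
  have := two_pi_div_pos k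
  have : 0 < 2 * Real.pi / k * (2 * b.re * b.im) := by positivity
  linarith

lemma differentiable_dilogNum (hre : 0 < b.re) (him : 0 < b.im) (n : ℤ) :
    Differentiable ℂ (dilogNum k b n) :=
  (differentiable_qPoch (norm_qPar_lt_one hre him)).comp
    ((differentiable_dilogVar k b n).const_mul _)

lemma differentiable_dilogDen (hb : ‖b‖ = 1) (hre : 0 < b.re) (him : 0 < b.im) (n : ℤ) :
    Differentiable ℂ (dilogDen k b n) :=
  (differentiable_qPoch (norm_qPar_inv_lt_one hb hre him)).comp (differentiable_dilogVar k b⁻¹ (-n))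

/-- In the upper half-plane the zeros of the denominator are simple and cancelled by zeros of the
numerator. -/
lemma dilogNum_eq_zero_of_dilogDen (hb : ‖b‖ = 1) (hre : 0 < b.re) (him : 0 < b.im) (n : ℤ) {μ : ℂ}
    (hμ : 0 < μ.im) (h : dilogDen k b n μ = 0) :
    dilogNum k b n μ = 0 ∧ deriv (dilogDen k b n) μ ≠ 0 := by
  have hp := norm_qPar_inv_lt_one (k := k) hb hre him
  have hk : (k : ℂ) ≠ 0 := NeZero.ne _
  have hb0 : b ≠ 0 := by rintro rfl; simp at hb
  have hpi : (Real.pi : ℂ) ≠ 0 := ofReal_ne_zero.2 Real.pi_ne_zero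
  obtain ⟨j, hj⟩ : ∃ j : ℕ, (qPar k b⁻¹)⁻¹ ^ j * dilogVar k b⁻¹ (-n) μ = 1 := by
    by_contra hcon
    push Not at hcon
    exact qPoch_ne_zero hp hcon h
  constructor
  · have hj' := hj
    rw [dilogVar, qPar, ← exp_neg, ← exp_nat_mul, ← exp_add, exp_eq_one_iff] at hj'
    obtain ⟨N, hN⟩ := hj'
    -- The zeros of the denominator, with `j ≥ 0` and `N` an integer. Because `Re b = Re b⁻¹`, the
    -- real part gives `(k N + n + 2 j) Re b = -Im μ < 0`. Hence `k N + n + j` is a negative integer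
    -- `-(i + 1)`, and factor `i` of the numerator vanishes.
    have e1 : I * μ = ((k * N + n + j : ℤ) : ℂ) * b + ((j : ℝ) : ℂ) * b⁻¹ := by
      field_simp at hN
      push_cast at hN ⊢
      field_simp
      linear_combination hN
    have e2 : ((k * N + n + j + j : ℤ) : ℝ) * b.re = -μ.im := by
      have := congrArg re e1
      rw [← ofReal_intCast, add_re, re_ofReal_mul, re_ofReal_mul, inv_re_of_norm hb, I_mul_re] at this
      push_cast at this ⊢
      linarith
    have e3 : k * N + n + j + j < 0 := by
      have : ((k * N + n + j + j : ℤ) : ℝ) < 0 := by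
        by_contra hcon
        have := mul_nonneg (not_lt.1 hcon) hre.le
        linarith
      exact_mod_cast this
    obtain ⟨i, hi⟩ : ∃ i : ℕ, (k * N + n + j : ℤ) = -(i + 1) :=
      ⟨(-(k * N + n + j) - 1).toNat, by omega⟩
    refine qPoch_eq_zero (j := i) ?_
    rw [dilogVar, qPar, ← exp_nat_mul, ← exp_add, ← exp_add, exp_eq_one_iff]
    refine ⟨-N, ?_⟩
    have e4 : I * μ = -(i + 1) * b + j * b⁻¹ := by rw [e1, hi]; push_cast; ring
    have e5 : (n : ℂ) = -(i + 1) - k * N - j := by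
      have := congrArg (Int.cast : ℤ → ℂ) hi
      push_cast at this
      linear_combination this
    have e6 : -I * b * μ = (i + 1) * b ^ 2 - j := by
      have : -I * b * μ = -b * (I * μ) := by ring
      rw [this, e4]
      field_simp
      ring
    rw [e6, e5]
    push_cast
    field_simp
    ring
  · have h1 : HasDerivAt (dilogVar k b⁻¹ (-n))
        (dilogVar k b⁻¹ (-n) μ * (-(2 * Real.pi * I / k) * (-I * b⁻¹))) μ := by
      have : HasDerivAt (fun μ : ℂ => -(2 * Real.pi * I / k) * (-I * b⁻¹ * μ - (-n : ℤ)))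
          (-(2 * Real.pi * I / k) * (-I * b⁻¹)) μ := by
        simpa only [mul_one] using
          (((hasDerivAt_id' μ).const_mul (-I * b⁻¹)).sub_const ((-n : ℤ) : ℂ)).const_mul (-(2 * Real.pi * I / k : ℂ))
      exact this.cexp
    have h2 := (differentiable_qPoch hp (dilogVar k b⁻¹ (-n) μ)).hasDerivAt.comp μ h1
    have h3 : deriv (dilogDen k b n) μ = _ := h2.deriv
    rw [h3]
    refine mul_ne_zero (deriv_qPoch_ne_zero hp j hj) (mul_ne_zero (exp_ne_zero _) ?_)
    simp [hk, hb0, hpi]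

lemma dilogFn_spec (hb : ‖b‖ = 1) (hre : 0 < b.re) (him : 0 < b.im) (n : ℤ) {μ : ℂ}
    (hμ : 0 < μ.im) :
    AnalyticAt ℂ (dilogFn k b n) μ ∧ (∀ᶠ w in 𝓝[≠] μ, dilogDen k b n w ≠ 0) ∧
      (fun w => dilogNum k b n w / dilogDen k b n w) =ᶠ[𝓝[≠] μ] dilogFn k b n := by
  obtain ⟨h1, F, hF, h2⟩ := exists_analyticAt_eq_div (differentiable_dilogNum (k := k) hre him n)
    (differentiable_dilogDen hb hre him n) (dilogNum_eq_zero_of_dilogDen hb hre him n hμ)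
  have h3 : dilogFn k b n =ᶠ[𝓝 μ] F := limUnder_punctured_eventuallyEq hF h2
  exact ⟨hF.congr h3.symm, h1, h2.trans (h3.symm.filter_mono nhdsWithin_le_nhds)⟩

lemma qPoch_eq_tprod_div {p q : ℂ} (hp : ‖p‖ < 1) (hq : ‖q‖ < 1) (u v : ℂ) (hv : qPoch p v ≠ 0) :
    ∏' j : ℕ, (1 - q ^ (j + 1) * u) / (1 - p ^ j * v) = qPoch q (q * u) / qPoch p v := by
  have h1 := (multipliable_qPoch hq (q * u)).hasProd
  have h2 := (multipliable_qPoch hp v).hasProd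
  have h3 : HasProd (fun j : ℕ => (1 - q ^ (j + 1) * u) / (1 - p ^ j * v))
      (qPoch q (q * u) / qPoch p v) := by
    have := h1.div₀ h2 hv
    simp only [pow_succ, mul_assoc]
    exact this
  exact h3.tprod_eq

lemma zVar_inv_eq (k : ℕ) (b μ : ℂ) (m : ZMod k) : (zVar k b μ m)⁻¹ = dilogVar k b m.val μ := by
  rw [zVar, dilogVar, ← exp_neg]
  congr 1
  push_cast
  ring

lemma zVarTilde_inv_eq (k : ℕ) (b μ : ℂ) (m : ZMod k) :
    (zVarTilde k b μ m)⁻¹ = dilogVar k b⁻¹ (-m.val) μ := by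
  rw [zVarTilde, dilogVar, ← exp_neg]
  congr 1
  push_cast
  ring

lemma qParTilde_eq (k : ℕ) (b : ℂ) : qParTilde k b = qPar k b⁻¹ := by
  rw [qParTilde, qPar, inv_pow]

/-- On the upper half-plane the quantum dilogarithm is `dilogFn`, for `b` or for `b⁻¹`. -/
lemma quantumDilog_eq_of_im_pos (hb : ‖b‖ = 1) (hre : 0 < b.re) (him : 0 < b.im) (m : ZMod k)
    {μ : ℂ} (hμ : 0 < μ.im) : quantumDilog k b μ m = dilogFn k b m.val μ := by
  obtain ⟨-, h, -⟩ := dilogFn_spec (k := k) hb hre him m.val hμ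
  have : (fun w => dilogProduct k b w m) =ᶠ[𝓝[≠] μ]
      fun w => dilogNum k b m.val w / dilogDen k b m.val w := by
    filter_upwards [h] with w hw
    rw [dilogProduct, if_pos (norm_qPar_lt_one hre him), zVar_inv_eq, zVarTilde_inv_eq, qParTilde_eq]
    exact qPoch_eq_tprod_div (norm_qPar_inv_lt_one hb hre him) (norm_qPar_lt_one hre him) _ _ hw
  rw [quantumDilog, dilogFn, limUnder, limUnder, map_congr this]

/-- The second product formula is the first one with `b` and `b⁻¹` exchanged and `m` negated. -/
lemma quantumDilog_eq_of_im_neg (hb : ‖b‖ = 1) (hre : 0 < b.re) (him : b.im < 0) (m : ZMod k)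
    {μ : ℂ} (hμ : 0 < μ.im) : quantumDilog k b μ m = dilogFn k b⁻¹ (-m.val) μ := by
  have hb' : ‖b⁻¹‖ = 1 := by rw [norm_inv, hb, inv_one]
  have hre' : 0 < b⁻¹.re := by rwa [inv_re_of_norm hb]
  have him' : 0 < b⁻¹.im := by rw [inv_im_of_norm hb]; linarith
  obtain ⟨-, h, -⟩ := dilogFn_spec (k := k) hb' hre' him' (-m.val) hμ
  have hq : ¬ ‖qPar k b‖ < 1 := by
    have := norm_qPar_inv_lt_one (k := k) hb' hre' him'
    rw [inv_inv, norm_inv] at this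
    intro hlt
    have h0 : 0 < ‖qPar k b‖ := norm_pos_iff.2 (exp_ne_zero _)
    exact absurd ((inv_lt_one₀ h0).1 this) (not_lt.2 hlt.le)
  have : (fun w => dilogProduct k b w m) =ᶠ[𝓝[≠] μ]
      fun w => dilogNum k b⁻¹ (-m.val) w / dilogDen k b⁻¹ (-m.val) w := by
    filter_upwards [h] with w hw
    rw [dilogProduct, if_neg hq, zVar_inv_eq, zVarTilde_inv_eq, qParTilde_eq]
    have e := qPoch_eq_tprod_div (norm_qPar_inv_lt_one (k := k) hb' hre' him')
      (norm_qPar_lt_one (k := k) hre' him') (dilogVar k b⁻¹ (-m.val) w) _ hw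
    rw [dilogNum, dilogDen, ← e, inv_inv, neg_neg]
  rw [quantumDilog, dilogFn, limUnder, limUnder, map_congr this]

/-! ### The difference equation -/

/-- The shift makes each Pochhammer symbol acquire one factor. Dividing is legitimate off the zeros
of the denominators, which are isolated; both sides are continuous, so the identity extends to all
points. -/
lemma dilogFn_shift (hb : ‖b‖ = 1) (hre : 0 < b.re) (him : 0 < b.im) (n : ℤ) {μ : ℂ}
    (hμ : 0 < μ.im) :
    dilogFn k b (n - 2) (μ - 2 * (b.im : ℂ)) * (1 - qPar k b⁻¹ * dilogVar k b⁻¹ (-n) μ) =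
      (1 - dilogVar k b n μ) * dilogFn k b n μ := by
  set d : ℂ := 2 * (b.im : ℂ) with hd
  have hμ' : 0 < (μ - d).im := by simpa [hd] using hμ
  obtain ⟨a1, n1, e1⟩ := dilogFn_spec (k := k) hb hre him n hμ
  obtain ⟨a2, n2, e2⟩ := dilogFn_spec (k := k) hb hre him (n - 2) hμ'
  have hsub : Tendsto (fun w => w - d) (𝓝[≠] μ) (𝓝[≠] (μ - d)) := by
    refine tendsto_nhdsWithin_iff.2 ⟨?_, ?_⟩
    · exact ((continuous_id.sub continuous_const).tendsto μ).mono_left nhdsWithin_le_nhds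
    · filter_upwards [self_mem_nhdsWithin] with w hw
      simpa [sub_eq_iff_eq_add] using hw
  have hq0 : qPar k b⁻¹ ≠ 0 := exp_ne_zero _
  have hev : (fun w => dilogFn k b (n - 2) (w - d) * (1 - qPar k b⁻¹ * dilogVar k b⁻¹ (-n) w))
      =ᶠ[𝓝[≠] μ] fun w => (1 - dilogVar k b n w) * dilogFn k b n w := by
    filter_upwards [n1, e1, hsub.eventually n2, hsub.eventually e2] with w h1 h2 h3 h4
    have hN : dilogNum k b (n - 2) (w - d) = (1 - dilogVar k b n w) * dilogNum k b n w := by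
      rw [dilogNum, hd, dilogVar_shift hb, qPoch_step (norm_qPar_lt_one hre him), dilogNum]
    have hD : dilogDen k b (n - 2) (w - d) =
        (1 - qPar k b⁻¹ * dilogVar k b⁻¹ (-n) w) * dilogDen k b n w := by
      rw [dilogDen, hd, dilogVar_inv_shift hb, qPoch_step (norm_qPar_inv_lt_one hb hre him), dilogDen,
        inv_mul_cancel_left₀ hq0]
    rw [← h2, ← h4, hN, hD]
    rw [hD] at h3
    have := left_ne_zero_of_mul h3
    generalize 1 - qPar k b⁻¹ * dilogVar k b⁻¹ (-n) w = u at this ⊢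
    field_simp
  have c2 : ContinuousAt (fun w => dilogFn k b (n - 2) (w - d)) μ :=
    a2.continuousAt.comp (f := fun w => w - d) (by fun_prop)
  have l1 : Tendsto (fun w => dilogFn k b (n - 2) (w - d) *
      (1 - qPar k b⁻¹ * dilogVar k b⁻¹ (-n) w)) (𝓝[≠] μ) (𝓝 _) :=
    (c2.mul (continuousAt_const.sub (continuousAt_const.mul
      (differentiable_dilogVar k b⁻¹ (-n)).continuous.continuousAt))).tendsto.mono_left
        nhdsWithin_le_nhds
  have l2 : Tendsto (fun w => (1 - dilogVar k b n w) * dilogFn k b n w) (𝓝[≠] μ) (𝓝 _) :=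
    ((continuousAt_const.sub (differentiable_dilogVar k b n).continuous.continuousAt).mul
      a1.continuousAt).tendsto.mono_left nhdsWithin_le_nhds
  exact tendsto_nhds_unique (l1.congr' hev) l2

end

/-! ## Growth of the quantum dilogarithm along horizontal lines -/

/-- Finitely many translations by `d` bring any `x ≤ X` into the window `[X - d, X]`. The label `n`
moves along, so the bound on the window has to be uniform in it. -/
lemma le_of_step_left {g : ℤ → ℝ → ℝ} {d X M : ℝ} (hd : 0 < d)
    (hstep : ∀ n x, x ≤ X → g (n - 2) (x - d) ≤ g n x)
    (hM : ∀ n, ∀ x ∈ Set.Icc (X - d) X, g n x ≤ M) : ∀ n x, x ≤ X → g n x ≤ M := by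
  have key : ∀ j : ℕ, ∀ n x, X - (j + 1) * d ≤ x → x ≤ X → g n x ≤ M := by
    intro j
    induction j with
    | zero => intro n x h1 h2; exact hM n x ⟨by simpa using h1, h2⟩
    | succ j ih =>
      intro n x h1 h2
      by_cases hx : X - d ≤ x
      · exact hM n x ⟨hx, h2⟩
      · push Not at hx
        have h3 := hstep (n + 2) (x + d) (by linarith)
        rw [add_sub_cancel_right, add_sub_cancel_right] at h3
        refine h3.trans (ih _ _ ?_ (by linarith))
        push_cast at h1
        linarith
  intro n x hx
  obtain ⟨j, hj⟩ := exists_nat_ge ((X - x) / d)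
  refine key j n x ?_ hx
  rw [div_le_iff₀ hd] at hj
  linarith

lemma le_of_step_right {g : ℤ → ℝ → ℝ} {d X M : ℝ} (hd : 0 < d)
    (hstep : ∀ n x, X + d ≤ x → g n x ≤ g (n - 2) (x - d))
    (hM : ∀ n, ∀ x ∈ Set.Icc X (X + d), g n x ≤ M) : ∀ n x, X ≤ x → g n x ≤ M := by
  have := le_of_step_left (g := fun n x => g (-n) (-x)) (X := -X) (M := M) hd
    (fun n x hx => by
      have := hstep (-(n - 2)) (-(x - d)) (by linarith)
      rwa [show -(n - 2) - 2 = -n by ring, show -(x - d) - d = -x by ring] at this)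
    (fun n x hx => hM _ _ ⟨by linarith [hx.2], by linarith [hx.1]⟩)
  intro n x hx
  simpa using this (-n) (-x) (by linarith)

/-- Puts the relative error `(1 + t) / (1 - t)` of one translation into exponential form, so that
errors of successive steps add up in the exponent. -/
lemma one_add_le_exp_mul_one_sub {t : ℝ} (h0 : 0 ≤ t) (h1 : t ≤ 1 / 2) :
    1 + t ≤ Real.exp (3 * t) * (1 - t) := by
  have h2 : 1 + 3 * t + (3 * t) ^ 2 / 2 ≤ Real.exp (3 * t) :=
    Real.quadratic_le_exp_of_nonneg (by linarith)
  have h3 : (1 + 3 * t + (3 * t) ^ 2 / 2) * (1 - t) ≤ Real.exp (3 * t) * (1 - t) :=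
    mul_le_mul_of_nonneg_right h2 (by linarith)
  refine le_trans ?_ h3
  nlinarith [mul_nonneg h0 (by linarith : (0:ℝ) ≤ 1 - 2 * t), mul_nonneg h0 h0, mul_nonneg (mul_nonneg h0 h0) (by linarith : (0:ℝ) ≤ 1 - 2 * t)]

section

variable {k : ℕ} [NeZero k] {b : ℂ}

/-- The point `x + i a`. -/
def hPt (x a : ℝ) : ℂ := (x : ℂ) + I * (a : ℂ)

@[simp] lemma hPt_re (x a : ℝ) : (hPt x a).re = x := by simp [hPt]

@[simp] lemma hPt_im (x a : ℝ) : (hPt x a).im = a := by simp [hPt]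

/-- The dilogarithm divided by its growth rate. -/
def dilogScaled (k : ℕ) (b : ℂ) (n : ℤ) (x a : ℝ) : ℝ :=
  ‖dilogFn k b n (hPt x a)‖ * Real.exp (-(2 * Real.pi / k) * ((a - b.re) * max 0 (-x)))

/-- The quotient `‖u‖ / ‖v‖ = exp ((2π/k) 2 Im b (a - Re b))` does not depend on `x`: it is the
growth per step built into `dilogScaled`. Far to the left `u` and `v` are both large, far to the
right both small. -/
lemma norm_dilogFn_shift (hb : ‖b‖ = 1) (hre : 0 < b.re) (him : 0 < b.im) (n : ℤ) (x : ℝ) {a : ℝ}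
    (ha : 0 < a) :
    ∃ u v : ℂ, ‖u‖ = Real.exp (-(2 * Real.pi / k) * (b.re * x - b.im * a)) ∧
      ‖v‖ = Real.exp (-(2 * Real.pi / k) * (b.re * x + b.im * a - 2 * b.im * b.re)) ∧
      ‖dilogFn k b (n - 2) (hPt (x - 2 * b.im) a)‖ * ‖1 - v‖ =
        ‖1 - u‖ * ‖dilogFn k b n (hPt x a)‖ := by
  refine ⟨dilogVar k b n (hPt x a), qPar k b⁻¹ * dilogVar k b⁻¹ (-n) (hPt x a), ?_, ?_, ?_⟩
  · rw [norm_dilogVar, mul_re, hPt_re, hPt_im]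
  · rw [norm_mul, norm_qPar, norm_dilogVar, ← Real.exp_add, mul_re, hPt_re, hPt_im,
      inv_re_of_norm hb, inv_im_of_norm hb]
    congr 1; ring
  · have h := dilogFn_shift (k := k) hb hre him n (μ := hPt x a) (by simpa using ha)
    rw [← norm_mul, ← norm_mul, ← h]
    congr 3
    simp [hPt]; ring

/-- With `u` and `v` large, `|1 - u| / |1 - v|` exceeds `‖u‖ / ‖v‖` by a factor of at most `exp (3
δ)`, where `δ` bounds `‖u‖⁻¹` and `‖v‖⁻¹` and shrinks by `r < 1` at each step to the left. The
weight `exp (K δ)` absorbs all these errors at once. -/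
lemma dilogScaled_left (hb : ‖b‖ = 1) (hre : 0 < b.re) (him : 0 < b.im) {a1 X M : ℝ} (hX : X ≤ 0)
    (hX' : 2 * Real.pi / k * (b.re * X + b.im * a1) ≤ -1) {a : ℝ} (ha : 0 < a) (ha1 : a ≤ a1)
    (hM : ∀ n, ∀ x ∈ Set.Icc (X - 2 * b.im) X, dilogScaled k b n x a ≤ M) :
    ∀ n x, x ≤ X → dilogScaled k b n x a ≤
      M * Real.exp (3 / (1 - Real.exp (-(2 * Real.pi / k) * (2 * b.im * b.re)))) := by
  set κ : ℝ := 2 * Real.pi / k with hκ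
  have hκ0 : 0 < κ := two_pi_div_pos k
  set r : ℝ := Real.exp (-κ * (2 * b.im * b.re)) with hr
  have hr1 : r < 1 := by
    rw [hr, Real.exp_lt_one_iff]
    have : 0 < κ * (2 * b.im * b.re) := by positivity
    linarith
  -- The solution of `K r + 3 = K`, that is, `3` times the geometric series in `r`.
  set K : ℝ := 3 / (1 - r) with hK
  have hr1' : 0 < 1 - r := by linarith
  have hK0 : 0 < K := by positivity
  have hKr : K * r + 3 = K := by rw [hK]; field_simp; ring
  set δ : ℝ → ℝ := fun x => Real.exp (κ * (b.re * x + b.im * a1)) with hδ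
  have hδ0 : ∀ x, 0 < δ x := fun x => Real.exp_pos _
  have hδ1 : ∀ x, x ≤ X → δ x ≤ 1 / 2 := by
    intro x hx
    have h1 : δ x ≤ Real.exp (-1) := by
      apply Real.exp_le_exp.2
      refine le_trans ?_ hX'
      gcongr
    have := Real.exp_neg_one_lt_d9
    linarith
  have hδs : ∀ x, δ (x - 2 * b.im) = r * δ x := by
    intro x
    simp only [hδ, hr]
    rw [← Real.exp_add]; congr 1; ring
  have ha1' : 0 < a1 := ha.trans_le ha1
  have hM0 : 0 ≤ M := le_trans (by unfold dilogScaled; positivity)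
    (hM 0 X ⟨by linarith, le_rfl⟩)
  have main := le_of_step_left (g := fun n x => dilogScaled k b n x a * Real.exp (K * δ x))
    (d := 2 * b.im) (X := X) (M := M * Real.exp K) (by linarith) ?_ ?_
  · intro n x hx
    refine le_trans ?_ (main n x hx)
    have h0 : 0 ≤ dilogScaled k b n x a := by unfold dilogScaled; positivity
    have : 1 ≤ Real.exp (K * δ x) := Real.one_le_exp (mul_nonneg hK0.le (hδ0 x).le)
    exact le_mul_of_one_le_right h0 this
  · intro n x hx
    obtain ⟨u, v, hu, hv, huv⟩ := norm_dilogFn_shift (k := k) hb hre him n x ha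
    have hδx := hδ1 x hx
    have hu' : ‖u‖⁻¹ ≤ δ x := by
      rw [hu, ← Real.exp_neg]
      apply Real.exp_le_exp.2
      have : 0 ≤ κ * b.im * (a1 + a) := by positivity
      nlinarith
    have hv' : ‖v‖⁻¹ ≤ δ x := by
      rw [hv, ← Real.exp_neg]
      apply Real.exp_le_exp.2
      have : 0 ≤ κ * b.im * (a1 - a) := mul_nonneg (by positivity) (by linarith)
      have : 0 ≤ κ * b.im * b.re := by positivity
      nlinarith
    have hu0 : 0 < ‖u‖ := by rw [hu]; exact Real.exp_pos _
    have hv0 : 0 < ‖v‖ := by rw [hv]; exact Real.exp_pos _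
    have h1 : ‖1 - u‖ ≤ ‖u‖ * (1 + δ x) := by
      calc ‖1 - u‖ ≤ 1 + ‖u‖ := by simpa using norm_sub_le (1 : ℂ) u
        _ = ‖u‖ * (1 + ‖u‖⁻¹) := by field_simp; ring
        _ ≤ _ := by gcongr
    have h2 : ‖v‖ * (1 - δ x) ≤ ‖1 - v‖ := by
      calc ‖v‖ * (1 - δ x) ≤ ‖v‖ * (1 - ‖v‖⁻¹) := by gcongr
        _ = ‖v‖ - 1 := by field_simp
        _ ≤ _ := by simpa [norm_sub_rev] using norm_sub_norm_le v 1
    have h3 := one_add_le_exp_mul_one_sub (hδ0 x).le hδx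
    set P' := ‖dilogFn k b (n - 2) (hPt (x - 2 * b.im) a)‖
    set P := ‖dilogFn k b n (hPt x a)‖
    have hP : 0 ≤ P := norm_nonneg _
    have hP' : 0 ≤ P' := norm_nonneg _
    have h4 : P' * ‖v‖ ≤ ‖u‖ * Real.exp (3 * δ x) * P := by
      have h5 : 0 < 1 - δ x := by linarith
      refine le_of_mul_le_mul_right ?_ h5
      calc P' * ‖v‖ * (1 - δ x) = P' * (‖v‖ * (1 - δ x)) := by ring
        _ ≤ P' * ‖1 - v‖ := by gcongr
        _ = ‖1 - u‖ * P := huv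
        _ ≤ (‖u‖ * (1 + δ x)) * P := by gcongr
        _ ≤ (‖u‖ * (Real.exp (3 * δ x) * (1 - δ x))) * P := by gcongr
        _ = _ := by ring
    have h6 : P' ≤ Real.exp (κ * (2 * b.im * (a - b.re))) * Real.exp (3 * δ x) * P := by
      refine le_of_mul_le_mul_right ?_ hv0
      refine h4.trans (le_of_eq ?_)
      have : ‖u‖ = Real.exp (κ * (2 * b.im * (a - b.re))) * ‖v‖ := by
        rw [hu, hv, ← Real.exp_add]; congr 1; ring
      rw [this]; ring
    simp only [dilogScaled]
    rw [max_eq_right (by linarith : 0 ≤ -x), max_eq_right (by linarith : 0 ≤ -(x - 2 * b.im)), hδs,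
      ← hκ]
    calc P' * Real.exp (-κ * ((a - b.re) * -(x - 2 * b.im))) * Real.exp (K * (r * δ x))
        ≤ (Real.exp (κ * (2 * b.im * (a - b.re))) * Real.exp (3 * δ x) * P) *
            Real.exp (-κ * ((a - b.re) * -(x - 2 * b.im))) * Real.exp (K * (r * δ x)) := by gcongr
      _ = P * (Real.exp (κ * (2 * b.im * (a - b.re))) * Real.exp (3 * δ x) *
            Real.exp (-κ * ((a - b.re) * -(x - 2 * b.im))) * Real.exp (K * (r * δ x))) := by ring
      _ = P * (Real.exp (-κ * ((a - b.re) * -x)) * Real.exp (K * δ x)) := by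
          congr 1
          simp only [← Real.exp_add]
          congr 1
          linear_combination δ x * hKr
      _ = _ := by ring
  · intro n x hx
    have hx2 : δ x ≤ 1 := (hδ1 x hx.2).trans (by norm_num)
    have : Real.exp (K * δ x) ≤ Real.exp K := Real.exp_le_exp.2 (by nlinarith)
    exact mul_le_mul (hM n x hx) this (Real.exp_pos _).le hM0

/-- Now `u` and `v` are small, the multiplier tends to `1` and the rate is zero. Here `δ` bounds
`‖u‖` and `‖v‖` and grows by `r > 1` under a step to the left, so `K` solves `3 + K = K r`. -/
lemma dilogScaled_right (hb : ‖b‖ = 1) (hre : 0 < b.re) (him : 0 < b.im) {a1 X M : ℝ} (hX : 0 ≤ X)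
    (hX' : 2 * Real.pi / k * (b.im * a1 + 2 * b.im * b.re - b.re * X) ≤ -1) {a : ℝ} (ha : 0 < a)
    (ha1 : a ≤ a1)
    (hM : ∀ n, ∀ x ∈ Set.Icc X (X + 2 * b.im), dilogScaled k b n x a ≤ M) :
    ∀ n x, X ≤ x → dilogScaled k b n x a ≤
      M * Real.exp (3 / (Real.exp (2 * Real.pi / k * (2 * b.im * b.re)) - 1)) := by
  set κ : ℝ := 2 * Real.pi / k with hκ
  have hκ0 : 0 < κ := two_pi_div_pos k
  set r : ℝ := Real.exp (κ * (2 * b.im * b.re)) with hr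
  have hr1 : 1 < r := by
    rw [hr, Real.one_lt_exp_iff]
    positivity
  set K : ℝ := 3 / (r - 1) with hK
  have hr1' : 0 < r - 1 := by linarith
  have hK0 : 0 < K := by positivity
  have hKr : 3 + K = K * r := by rw [hK]; field_simp; ring
  set δ : ℝ → ℝ := fun x => Real.exp (κ * (b.im * a1 + 2 * b.im * b.re - b.re * x)) with hδ
  have hδ0 : ∀ x, 0 < δ x := fun x => Real.exp_pos _
  have hδ1 : ∀ x, X ≤ x → δ x ≤ 1 / 2 := by
    intro x hx
    have h1 : δ x ≤ Real.exp (-1) := by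
      apply Real.exp_le_exp.2
      refine le_trans ?_ hX'
      gcongr
    have := Real.exp_neg_one_lt_d9
    linarith
  have hδs : ∀ x, δ (x - 2 * b.im) = r * δ x := by
    intro x
    simp only [hδ, hr]
    rw [← Real.exp_add]; congr 1; ring
  have ha1' : 0 < a1 := ha.trans_le ha1
  have hM0 : 0 ≤ M := le_trans (by unfold dilogScaled; positivity)
    (hM 0 X ⟨le_rfl, by linarith⟩)
  have main := le_of_step_right (g := fun n x => dilogScaled k b n x a * Real.exp (K * δ x))
    (d := 2 * b.im) (X := X) (M := M * Real.exp K) (by linarith) ?_ ?_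
  · intro n x hx
    refine le_trans ?_ (main n x hx)
    have h0 : 0 ≤ dilogScaled k b n x a := by unfold dilogScaled; positivity
    have : 1 ≤ Real.exp (K * δ x) := Real.one_le_exp (mul_nonneg hK0.le (hδ0 x).le)
    exact le_mul_of_one_le_right h0 this
  · intro n x hx
    obtain ⟨u, v, hu, hv, huv⟩ := norm_dilogFn_shift (k := k) hb hre him n x ha
    have hδx := hδ1 x (by linarith)
    have hu' : ‖u‖ ≤ δ x := by
      rw [hu]
      apply Real.exp_le_exp.2
      have : 0 ≤ κ * b.im * (a1 - a) := mul_nonneg (by positivity) (by linarith)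
      have : 0 ≤ κ * b.im * b.re := by positivity
      nlinarith
    have hv' : ‖v‖ ≤ δ x := by
      rw [hv]
      apply Real.exp_le_exp.2
      have : 0 ≤ κ * b.im * (a1 + a) := by positivity
      nlinarith
    have h1 : ‖1 - v‖ ≤ 1 + δ x := by
      calc ‖1 - v‖ ≤ 1 + ‖v‖ := by simpa using norm_sub_le (1 : ℂ) v
        _ ≤ _ := by gcongr
    have h2 : 1 - δ x ≤ ‖1 - u‖ := by
      calc 1 - δ x ≤ 1 - ‖u‖ := by gcongr
        _ ≤ _ := by simpa using norm_sub_norm_le (1 : ℂ) u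
    have h3 := one_add_le_exp_mul_one_sub (hδ0 x).le hδx
    set P' := ‖dilogFn k b (n - 2) (hPt (x - 2 * b.im) a)‖
    set P := ‖dilogFn k b n (hPt x a)‖
    have hP : 0 ≤ P := norm_nonneg _
    have hP' : 0 ≤ P' := norm_nonneg _
    have h4 : P ≤ P' * Real.exp (3 * δ x) := by
      have h5 : 0 < 1 - δ x := by linarith
      refine le_of_mul_le_mul_right ?_ h5
      calc P * (1 - δ x) ≤ P * ‖1 - u‖ := by gcongr
        _ = P' * ‖1 - v‖ := by rw [huv]; ring
        _ ≤ P' * (1 + δ x) := by gcongr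
        _ ≤ P' * (Real.exp (3 * δ x) * (1 - δ x)) := by gcongr
        _ = _ := by ring
    simp only [dilogScaled]
    rw [max_eq_left (by linarith : -x ≤ 0), max_eq_left (by linarith : -(x - 2 * b.im) ≤ 0), hδs,
      mul_zero, mul_zero, Real.exp_zero, mul_one, mul_one]
    calc P * Real.exp (K * δ x) ≤ (P' * Real.exp (3 * δ x)) * Real.exp (K * δ x) := by gcongr
      _ = P' * (Real.exp (3 * δ x) * Real.exp (K * δ x)) := by ring
      _ = _ := by
          rw [← Real.exp_add]
          congr 2
          linear_combination δ x * hKr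
  · intro n x hx
    have hx2 : δ x ≤ 1 := (hδ1 x hx.1).trans (by norm_num)
    have : Real.exp (K * δ x) ≤ Real.exp K := Real.exp_le_exp.2 (by nlinarith)
    exact mul_le_mul (hM n x hx) this (Real.exp_pos _).le hM0

/-- Compactness bounds each `n` separately; periodicity modulo `k` leaves only `k` of them, whence
the sum over residues. -/
lemma exists_dilogScaled_le_compact (hb : ‖b‖ = 1) (hre : 0 < b.re) (him : 0 < b.im) {a0 a1 : ℝ}
    (h0 : 0 < a0) (X Y : ℝ) : ∃ M : ℝ, ∀ n : ℤ, ∀ x ∈ Set.Icc X Y, ∀ a ∈ Set.Icc a0 a1,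
      dilogScaled k b n x a ≤ M := by
  have h1 : ∀ n : ℤ, ∃ M : ℝ, ∀ x ∈ Set.Icc X Y, ∀ a ∈ Set.Icc a0 a1,
      dilogScaled k b n x a ≤ M := by
    intro n
    have hc : ContinuousOn (fun p : ℝ × ℝ => dilogScaled k b n p.1 p.2)
        (Set.Icc X Y ×ˢ Set.Icc a0 a1) := by
      intro p hp
      have hpos : 0 < (hPt p.1 p.2).im := by rw [hPt_im]; exact h0.trans_le hp.2.1
      have e1 := (dilogFn_spec (k := k) hb hre him n hpos).1.continuousAt
      have e2 : ContinuousAt (fun p : ℝ × ℝ => hPt p.1 p.2) p := by unfold hPt; fun_prop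
      have e3 : ContinuousAt (fun p : ℝ × ℝ => dilogFn k b n (hPt p.1 p.2)) p :=
        ContinuousAt.comp (f := fun p : ℝ × ℝ => hPt p.1 p.2) e1 e2
      have e4 : ContinuousAt (fun p : ℝ × ℝ =>
          Real.exp (-(2 * Real.pi / k) * ((p.2 - b.re) * max 0 (-p.1)))) p := by fun_prop
      exact (e3.norm.mul e4).continuousWithinAt
    obtain ⟨M, hM⟩ := (isCompact_Icc.prod isCompact_Icc).exists_bound_of_continuousOn hc
    exact ⟨M, fun x hx a ha => (le_abs_self _).trans (hM (x, a) ⟨hx, ha⟩)⟩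
  choose M hM using h1
  refine ⟨∑ r ∈ Finset.range k, |M r|, fun n x hx a ha => ?_⟩
  have hk : (0 : ℤ) < k := by exact_mod_cast Nat.pos_of_ne_zero (NeZero.ne k)
  obtain ⟨r, hr⟩ := Int.eq_ofNat_of_zero_le (Int.emod_nonneg n hk.ne')
  have hlt : r < k := by
    have := Int.emod_lt_of_pos n hk
    omega
  have hn : n = r + k * (n / k) := by rw [← hr]; exact (Int.emod_add_mul_ediv n k).symm
  have : dilogScaled k b n x a = dilogScaled k b r x a := by
    rw [dilogScaled, dilogScaled, hn, dilogFn_add_mul]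
  rw [this]
  exact ((hM r x hx a ha).trans (le_abs_self _)).trans
    (Finset.single_le_sum (f := fun r : ℕ => |M r|) (fun i _ => abs_nonneg _) (Finset.mem_range.2 hlt))

lemma exists_dilogScaled_le (hb : ‖b‖ = 1) (hre : 0 < b.re) (him : 0 < b.im) {a0 a1 : ℝ}
    (h0 : 0 < a0) (h1 : a0 ≤ a1) : ∃ M : ℝ, ∀ (n : ℤ) (x : ℝ), ∀ a ∈ Set.Icc a0 a1,
      dilogScaled k b n x a ≤ M := by
  set κ : ℝ := 2 * Real.pi / k with hκ
  have hκ0 : 0 < κ := two_pi_div_pos k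
  have ha1 : 0 < a1 := h0.trans_le h1
  -- Makes the exponent in the right-hand smallness condition equal to `-1`; the left-hand one at
  -- `-X` is then even smaller.
  set X : ℝ := (κ⁻¹ + b.im * a1 + 2 * b.im * b.re) / b.re with hX
  have hX0 : 0 ≤ X := by positivity
  have hXr : b.re * X = κ⁻¹ + b.im * a1 + 2 * b.im * b.re := by rw [hX]; field_simp
  have hκκ : κ * κ⁻¹ = 1 := mul_inv_cancel₀ hκ0.ne'
  obtain ⟨M, hM⟩ := exists_dilogScaled_le_compact (k := k) hb hre him h0 (a1 := a1)
    (-X - 2 * b.im) (X + 2 * b.im)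
  have hM0 : 0 ≤ M := le_trans (by unfold dilogScaled; positivity)
    (hM 0 0 ⟨by linarith, by linarith⟩ a0 ⟨le_rfl, h1⟩)
  have hL := fun a (ha : a ∈ Set.Icc a0 a1) => dilogScaled_left (k := k) hb hre him (a1 := a1) (X := -X) (M := M)
    (by linarith) (by
      rw [← hκ]
      have : 0 ≤ κ * (b.im * b.re) := by positivity
      nlinarith) (h0.trans_le ha.1) ha.2
    (fun n x hx => hM n x ⟨hx.1, by linarith [hx.2]⟩ a ha)
  have hR := fun a (ha : a ∈ Set.Icc a0 a1) => dilogScaled_right (k := k) hb hre him (a1 := a1) (X := X) (M := M)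
    hX0 (by
      rw [← hκ, hXr]
      nlinarith) (h0.trans_le ha.1) ha.2
    (fun n x hx => hM n x ⟨by linarith [hx.1], hx.2⟩ a ha)
  rw [← hκ] at hL hR
  set K1 := Real.exp (3 / (1 - Real.exp (-κ * (2 * b.im * b.re))))
  set K2 := Real.exp (3 / (Real.exp (κ * (2 * b.im * b.re)) - 1))
  have hK1 : 0 ≤ M * K1 := mul_nonneg hM0 (Real.exp_pos _).le
  have hK2 : 0 ≤ M * K2 := mul_nonneg hM0 (Real.exp_pos _).le
  refine ⟨M + M * K1 + M * K2, fun n x a ha => ?_⟩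
  rcases le_total x (-X) with hx | hx
  · linarith [hL a ha n x hx]
  rcases le_total X x with hx' | hx'
  · linarith [hR a ha n x hx']
  · linarith [hM n x ⟨by linarith, by linarith⟩ a ha]

end

/-- Growth of the quantum dilogarithm, uniformly on closed horizontal strips in the upper
half-plane. -/
lemma exists_norm_quantumDilog_le {k : ℕ} [NeZero k] {b : ℂ} (hb : ‖b‖ = 1) (hre : 0 < b.re)
    (him : b.im ≠ 0) {a0 a1 : ℝ} (h0 : 0 < a0) (h1 : a0 ≤ a1) :
    ∃ M : ℝ, 0 ≤ M ∧ ∀ (m : ZMod k) (μ : ℂ), μ.im ∈ Set.Icc a0 a1 →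
      ‖quantumDilog k b μ m‖ ≤
        M * Real.exp (2 * Real.pi / k * ((μ.im - Qb b / 2) * max 0 (-μ.re))) := by
  -- The bound sees `b` only through `Re b = Q / 2`, which `b` and `b⁻¹` share, so both signs of `Im
  -- b` lead to the same estimate.
  have key : ∀ (b' : ℂ) (n : ZMod k → ℤ), b'.re = b.re →
      (∀ (m : ZMod k) (μ : ℂ), 0 < μ.im → quantumDilog k b μ m = dilogFn k b' (n m) μ) →
      ∀ M : ℝ, (∀ (n : ℤ) (x : ℝ), ∀ a ∈ Set.Icc a0 a1, dilogScaled k b' n x a ≤ M) →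
      ∃ M : ℝ, 0 ≤ M ∧ ∀ (m : ZMod k) (μ : ℂ), μ.im ∈ Set.Icc a0 a1 →
        ‖quantumDilog k b μ m‖ ≤
          M * Real.exp (2 * Real.pi / k * ((μ.im - Qb b / 2) * max 0 (-μ.re))) := by
    intro b' n hre' heq M hM
    refine ⟨M, le_trans (by unfold dilogScaled; positivity) (hM 0 0 a0 ⟨le_rfl, h1⟩), fun m μ hμ => ?_⟩
    have h2 := hM (n m) μ.re μ.im hμ
    have h3 : hPt μ.re μ.im = μ := by apply Complex.ext <;> simp
    rw [dilogScaled, h3, neg_mul, Real.exp_neg, ← div_eq_mul_inv, div_le_iff₀ (Real.exp_pos _), hre'] at h2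
    rwa [heq m μ (h0.trans_le hμ.1), Qb_eq hb, mul_div_cancel_left₀ _ (two_ne_zero' ℝ)]
  rcases lt_or_gt_of_ne him with him | him
  · have hb' : ‖b⁻¹‖ = 1 := by rw [norm_inv, hb, inv_one]
    obtain ⟨M, hM⟩ := exists_dilogScaled_le (k := k) hb' (by rwa [inv_re_of_norm hb])
      (by rw [inv_im_of_norm hb]; linarith) h0 h1
    exact key b⁻¹ _ (inv_re_of_norm hb) (fun m μ hμ => quantumDilog_eq_of_im_neg hb hre him m hμ) M hM
  · obtain ⟨M, hM⟩ := exists_dilogScaled_le (k := k) hb hre him h0 h1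
    exact key b _ rfl (fun m μ hμ => quantumDilog_eq_of_im_pos hb hre him m hμ) M hM

lemma differentiableAt_quantumDilog {k : ℕ} [NeZero k] {b : ℂ} (hb : ‖b‖ = 1) (hre : 0 < b.re)
    (him : b.im ≠ 0) (m : ZMod k) {μ : ℂ} (hμ : 0 < μ.im) :
    DifferentiableAt ℂ (fun μ => quantumDilog k b μ m) μ := by
  have hev : ∀ᶠ w : ℂ in 𝓝 μ, 0 < w.im := continuous_im.continuousAt.eventually_const_lt hμ
  rcases lt_or_gt_of_ne him with him | him
  · have hb' : ‖b⁻¹‖ = 1 := by rw [norm_inv, hb, inv_one]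
    refine (dilogFn_spec (k := k) hb' (by rwa [inv_re_of_norm hb])
      (by rw [inv_im_of_norm hb]; linarith) (-m.val) hμ).1.differentiableAt.congr_of_eventuallyEq ?_
    filter_upwards [hev] with w hw using quantumDilog_eq_of_im_neg hb hre him m hw
  · refine (dilogFn_spec (k := k) hb hre him m.val hμ).1.differentiableAt.congr_of_eventuallyEq ?_
    filter_upwards [hev] with w hw using quantumDilog_eq_of_im_pos hb hre him m hw

/-! ## Decay of the octahedron partition function -/

lemma mul_le_neg_of_le {c e u : ℝ} (hc : c ≤ -e) (hu : 0 ≤ u) : u * c ≤ -(e * u) := by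
  nlinarith

/-- A piecewise linear function on the fan cut out by the coordinate planes and the plane
`∑ yᵢ = 0` that is negative on the extremal rays `-eᵢ`, `eᵢ`, `eᵢ - eⱼ` is negative. -/
lemma octahedron_piecewise_linear {h ε : ℝ} {α β y : Fin 3 → ℝ} (hε : 0 < ε)
    (h1 : ∀ i, α i + β i + ε ≤ h) (h2 : ∀ i, h + ε ≤ (∑ j, α j) + β i)
    (h3 : ∀ i j, i ≠ j → α j + β j - β i + ε ≤ h) :
    -(∑ i, β i * y i) + ∑ i, (α i - h) * max 0 (-y i) + (h - ∑ i, α i) * max 0 (∑ i, y i) ≤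
      -(ε / 2) * ∑ i, |y i| := by
  obtain ⟨p, n, hp, hn, hpn, hy, hm, habs⟩ : ∃ p n : Fin 3 → ℝ, (∀ i, 0 ≤ p i) ∧ (∀ i, 0 ≤ n i) ∧
      (∀ i, p i * n i = 0) ∧ (∀ i, y i = p i - n i) ∧ (∀ i, max 0 (-y i) = n i) ∧
      ∀ i, |y i| = p i + n i := by
    refine ⟨fun i => max 0 (y i), fun i => max 0 (-y i), fun i => le_max_left _ _,
      fun i => le_max_left _ _, fun i => ?_, fun i => ?_, fun i => rfl, fun i => ?_⟩ <;>
    rcases le_total 0 (y i) with h | h <;> simp [h, abs_of_nonneg, abs_of_nonpos]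
  simp only [hm, habs]
  simp only [hy]
  have c01 := h3 0 1 (by decide)
  have c02 := h3 0 2 (by decide)
  have c10 := h3 1 0 (by decide)
  have c12 := h3 1 2 (by decide)
  have c20 := h3 2 0 (by decide)
  have c21 := h3 2 1 (by decide)
  have a0 := h1 0
  have a1 := h1 1
  have a2 := h1 2
  have d0 := h2 0
  have d1 := h2 1
  have d2 := h2 2
  have z0 := hpn 0
  have z1 := hpn 1
  have z2 := hpn 2
  have p0 := hp 0
  have p1 := hp 1
  have p2 := hp 2
  have n0 := hn 0
  have n1 := hn 1
  have n2 := hn 2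
  simp only [Fin.sum_univ_three] at *
  generalize α 0 = α0 at *
  generalize α 1 = α1 at *
  generalize α 2 = α2 at *
  generalize β 0 = β0 at *
  generalize β 1 = β1 at *
  generalize β 2 = β2 at *
  generalize p 0 = x0 at *
  generalize p 1 = x1 at *
  generalize p 2 = x2 at *
  generalize n 0 = y0 at *
  generalize n 1 = y1 at *
  generalize n 2 = y2 at *
  -- Here `xᵢ` and `yᵢ` are the positive and negative parts, with sums `P` and `N`. If `P ≥ N`, then
  -- `P (x - y) = ∑ xᵢ yⱼ (eᵢ - eⱼ) + (P - N) ∑ xᵢ eᵢ`; if `N ≥ P`, then `N (x - y) = ∑ xᵢ yⱼ (eᵢ -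
  -- eⱼ) - (N - P) ∑ yᵢ eᵢ`. The diagonal terms vanish because `xᵢ yᵢ = 0`. The bounds on the rays
  -- are added with these weights and the factor `P` or `N` is cancelled; the larger of `P` and `N`
  -- is at least half of `∑ |xᵢ - yᵢ|`.
  have m01 := mul_le_neg_of_le (c := α1 + β1 - β0 - h) (e := ε) (by linarith) (mul_nonneg p0 n1)
  have m02 := mul_le_neg_of_le (c := α2 + β2 - β0 - h) (e := ε) (by linarith) (mul_nonneg p0 n2)
  have m10 := mul_le_neg_of_le (c := α0 + β0 - β1 - h) (e := ε) (by linarith) (mul_nonneg p1 n0)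
  have m12 := mul_le_neg_of_le (c := α2 + β2 - β1 - h) (e := ε) (by linarith) (mul_nonneg p1 n2)
  have m20 := mul_le_neg_of_le (c := α0 + β0 - β2 - h) (e := ε) (by linarith) (mul_nonneg p2 n0)
  have m21 := mul_le_neg_of_le (c := α1 + β1 - β2 - h) (e := ε) (by linarith) (mul_nonneg p2 n1)
  rcases le_total (y0 + y1 + y2) (x0 + x1 + x2) with hS | hS
  · have hS' : 0 ≤ (x0 + x1 + x2) - (y0 + y1 + y2) := by linarith
    have e0 := mul_le_neg_of_le (c := h - (α0 + α1 + α2) - β0) (e := ε) (by linarith) (mul_nonneg hS' p0)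
    have e1 := mul_le_neg_of_le (c := h - (α0 + α1 + α2) - β1) (e := ε) (by linarith) (mul_nonneg hS' p1)
    have e2 := mul_le_neg_of_le (c := h - (α0 + α1 + α2) - β2) (e := ε) (by linarith) (mul_nonneg hS' p2)
    rw [max_eq_right (by linarith)]
    rcases (add_nonneg (add_nonneg p0 p1) p2).eq_or_lt with hP | hP
    · have : x0 = 0 := by linarith
      have : x1 = 0 := by linarith
      have : x2 = 0 := by linarith
      have : y0 = 0 := by linarith
      have : y1 = 0 := by linarith
      have : y2 = 0 := by linarith
      subst_vars
      simp
    · have hL : -(β0 * (x0 - y0) + β1 * (x1 - y1) + β2 * (x2 - y2)) +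
          ((α0 - h) * y0 + (α1 - h) * y1 + (α2 - h) * y2) +
          (h - (α0 + α1 + α2)) * (x0 - y0 + (x1 - y1) + (x2 - y2)) ≤ -ε * (x0 + x1 + x2) := by
        refine le_of_mul_le_mul_left ?_ hP
        linear_combination m01 + m02 + m10 + m12 + m20 + m21 + e0 + e1 + e2 +
          (α0 - h + ε) * z0 + (α1 - h + ε) * z1 + (α2 - h + ε) * z2
      have := mul_nonneg hε.le hS'
      linarith
  · have hS' : 0 ≤ (y0 + y1 + y2) - (x0 + x1 + x2) := by linarith
    have e0 := mul_le_neg_of_le (c := α0 + β0 - h) (e := ε) (by linarith) (mul_nonneg hS' n0)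
    have e1 := mul_le_neg_of_le (c := α1 + β1 - h) (e := ε) (by linarith) (mul_nonneg hS' n1)
    have e2 := mul_le_neg_of_le (c := α2 + β2 - h) (e := ε) (by linarith) (mul_nonneg hS' n2)
    rw [max_eq_left (by linarith)]
    rcases (add_nonneg (add_nonneg n0 n1) n2).eq_or_lt with hP | hP
    · have : x0 = 0 := by linarith
      have : x1 = 0 := by linarith
      have : x2 = 0 := by linarith
      have : y0 = 0 := by linarith
      have : y1 = 0 := by linarith
      have : y2 = 0 := by linarith
      subst_vars
      simp
    · have hL : -(β0 * (x0 - y0) + β1 * (x1 - y1) + β2 * (x2 - y2)) +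
          ((α0 - h) * y0 + (α1 - h) * y1 + (α2 - h) * y2) +
          (h - (α0 + α1 + α2)) * 0 ≤ -ε * (y0 + y1 + y2) := by
        refine le_of_mul_le_mul_left ?_ hP
        linear_combination m01 + m02 + m10 + m12 + m20 + m21 + e0 + e1 + e2 +
          (α0 - h + ε) * z0 + (α1 - h + ε) * z1 + (α2 - h + ε) * z2
      have := mul_nonneg hε.le hS'
      linarith

/-- The conditions that define the octahedron polytope, with a margin `ε`. -/
structure OctMargin (b : ℂ) (ε : ℝ) (α β : Fin 3 → ℝ) : Prop where
  pos : ∀ i, ε ≤ α i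
  sum_le : (∑ i, α i) + ε ≤ Qb b
  neg_ray : ∀ i, α i + β i + ε ≤ Qb b / 2
  pos_ray : ∀ i, Qb b / 2 + ε ≤ (∑ j, α j) + β i
  diff_ray : ∀ i j, i ≠ j → α j + β j - β i + ε ≤ Qb b / 2

/-- The margin keeps the imaginary parts of all four arguments in `[ε, Q]`, so one constant serves
for every factor. Their exponents add up to the function of `octahedron_piecewise_linear` with `h =
Q / 2`. The constant depends on the angles only through `ε`. -/
lemma exists_norm_Zoct_le {k : ℕ} [NeZero k] {b : ℂ} (hb : ‖b‖ = 1) (hre : 0 < b.re)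
    (him : b.im ≠ 0) {ε : ℝ} (hε : 0 < ε) :
    ∃ C : ℝ, 0 ≤ C ∧ ∀ (m : Fin 3 → ZMod k) (μ : Fin 3 → ℂ) (β : Fin 3 → ℝ),
      OctMargin b ε (fun i => (μ i).im) β →
      Real.exp (-(2 * Real.pi / k) * ∑ i, β i * (μ i).re) * ‖Zoct k b μ m‖ ≤
        C * Real.exp (-(2 * Real.pi / k * (ε / 2)) * ∑ i, |(μ i).re|) := by
  have hκ0 := two_pi_div_pos k
  obtain ⟨M, hM0, hM⟩ := exists_norm_quantumDilog_le (k := k) hb hre him hε (le_max_right (Qb b) ε)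
  refine ⟨M ^ 4, by positivity, fun m μ β h => ?_⟩
  set κ : ℝ := 2 * Real.pi / k with hκ
  have hs := h.sum_le
  have hp := h.pos
  simp only [Fin.sum_univ_three] at hs
  have hi : ∀ i, (μ i).im ≤ Qb b := by
    intro i
    have q0 := hp 0
    have q1 := hp 1
    have q2 := hp 2
    fin_cases i <;> simp <;> linarith
  have b0 : ∀ i, ‖quantumDilog k b (μ i) (m i)‖ ≤ _ :=
    fun i => hM (m i) (μ i) ⟨hp i, (hi i).trans (le_max_left _ _)⟩
  set w : ℂ := I * (Qb b : ℂ) - μ 0 - μ 1 - μ 2 with hw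
  have hwim : w.im = Qb b - ((μ 0).im + (μ 1).im + (μ 2).im) := by simp [hw]; ring
  have hwre : -w.re = (μ 0).re + (μ 1).re + (μ 2).re := by simp [hw]; ring
  have b3 := hM (-m 0 - m 1 - m 2) w ⟨by rw [hwim]; linarith, by
    refine le_trans ?_ (le_max_left _ _)
    rw [hwim]; linarith [hp 0, hp 1, hp 2]⟩
  have hpl := octahedron_piecewise_linear (y := fun i => (μ i).re) hε h.neg_ray h.pos_ray h.diff_ray
  rw [hwre, hwim] at b3
  rw [Zoct, ← hw, norm_mul, norm_mul, norm_mul]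
  simp only [Fin.sum_univ_three] at hpl ⊢
  calc _ ≤ Real.exp (-κ * (β 0 * (μ 0).re + β 1 * (μ 1).re + β 2 * (μ 2).re)) *
        ((M * Real.exp (κ * (((μ 0).im - Qb b / 2) * max 0 (-(μ 0).re)))) *
        (M * Real.exp (κ * (((μ 1).im - Qb b / 2) * max 0 (-(μ 1).re)))) *
        (M * Real.exp (κ * (((μ 2).im - Qb b / 2) * max 0 (-(μ 2).re)))) *
        (M * Real.exp (κ * ((Qb b - ((μ 0).im + (μ 1).im + (μ 2).im) - Qb b / 2) *
          max 0 ((μ 0).re + (μ 1).re + (μ 2).re))))) := by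
        have c0 := b0 0
        have c1 := b0 1
        have c2 := b0 2
        gcongr
    _ = M ^ 4 * (Real.exp (-κ * (β 0 * (μ 0).re + β 1 * (μ 1).re + β 2 * (μ 2).re)) *
        (Real.exp (κ * (((μ 0).im - Qb b / 2) * max 0 (-(μ 0).re))) *
        Real.exp (κ * (((μ 1).im - Qb b / 2) * max 0 (-(μ 1).re))) *
        Real.exp (κ * (((μ 2).im - Qb b / 2) * max 0 (-(μ 2).re))) *
        Real.exp (κ * ((Qb b - ((μ 0).im + (μ 1).im + (μ 2).im) - Qb b / 2) *
          max 0 ((μ 0).re + (μ 1).re + (μ 2).re))))) := by ring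
    _ ≤ _ := by
        simp only [← Real.exp_add]
        gcongr
        have := mul_le_mul_of_nonneg_left hpl hκ0.le
        refine le_trans (le_of_eq ?_) (this.trans (le_of_eq ?_)) <;> ring

lemma differentiableAt_Zoct {k : ℕ} [NeZero k] {b : ℂ} (hb : ‖b‖ = 1) (hre : 0 < b.re)
    (him : b.im ≠ 0) {E : Type*} [NormedAddCommGroup E] [NormedSpace ℂ E] {μ : E → Fin 3 → ℂ}
    (m : Fin 3 → ZMod k) {ν : E} (hμ : ∀ i, DifferentiableAt ℂ (fun ν => μ ν i) ν)
    (hpos : ∀ i, 0 < (μ ν i).im) (hsum : ∑ i, (μ ν i).im < Qb b) :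
    DifferentiableAt ℂ (fun ν => Zoct k b (μ ν) m) ν := by
  have hq : ∀ (f : E → ℂ) (n : ZMod k), DifferentiableAt ℂ f ν → 0 < (f ν).im →
      DifferentiableAt ℂ (fun ν => quantumDilog k b (f ν) n) ν := fun f n hf h =>
    DifferentiableAt.comp (g := fun μ => quantumDilog k b μ n) ν
      (differentiableAt_quantumDilog hb hre him n h) hf
  unfold Zoct
  refine ((((hq _ _ (hμ 0) (hpos 0)).mul (hq _ _ (hμ 1) (hpos 1))).mul
    (hq _ _ (hμ 2) (hpos 2))).mul (hq _ _ ?_ ?_))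
  · exact (((differentiableAt_const _).sub (hμ 0)).sub (hμ 1)).sub (hμ 2)
  · rw [Fin.sum_univ_three] at hsum
    simp
    linarith

/-! ## Contour deformation -/

lemma integrable_exp_neg_sum_abs {n : ℕ} {ε : ℝ} (hε : 0 < ε) :
    Integrable (fun x : Fin n → ℝ => Real.exp (-ε * ∑ i, |x i|)) := by
  have h1 : Integrable (fun x : ℝ => Real.exp (-ε * |x|)) := by
    have h0 := exp_neg_integrableOn_Ioi 0 hε
    have h2 : IntegrableOn (fun x : ℝ => Real.exp (-ε * |x|)) (Set.Ioi 0) :=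
      h0.congr_fun (fun x hx => by simp only [abs_of_pos (Set.mem_Ioi.1 hx)]) measurableSet_Ioi
    have h3 : IntegrableOn (fun x : ℝ => Real.exp (-ε * |x|)) (Set.Iic 0) := by
      refine (integrableOn_exp_mul_Iic hε 0).congr_fun (fun x hx => ?_) measurableSet_Iic
      simp only [abs_of_nonpos (Set.mem_Iic.1 hx), neg_mul_neg]
    rw [← integrableOn_univ, ← Set.Iic_union_Ioi (a := (0 : ℝ))]
    exact h3.union h2
  have h2 := Integrable.fintype_prod (ι := Fin n) (f := fun _ x => Real.exp (-ε * |x|)) (fun _ => h1)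
  refine h2.congr (.of_forall fun x => ?_)
  simp only [← Real.exp_sum, Finset.mul_sum]

lemma exp_neg_sum_abs_add_le {n : ℕ} {ε : ℝ} (hε : 0 < ε) (x v : Fin n → ℝ) {s : ℝ}
    (hs : s ∈ Set.Icc (0 : ℝ) 1) :
    Real.exp (-ε * ∑ i, |x i + s * v i|) ≤
      Real.exp (ε * ∑ i, |v i|) * Real.exp (-ε * ∑ i, |x i|) := by
  rw [← Real.exp_add, Real.exp_le_exp]
  have : ∑ i, |x i| ≤ ∑ i, |x i + s * v i| + ∑ i, |v i| := by
    rw [← Finset.sum_add_distrib]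
    refine Finset.sum_le_sum fun i _ => ?_
    have h1 : |x i| ≤ |x i + s * v i| + |s * v i| := by
      simpa using abs_sub (x i + s * v i) (s * v i)
    have h2 : |s * v i| ≤ |v i| := by
      rw [abs_mul, abs_of_nonneg hs.1]
      exact mul_le_of_le_one_left (abs_nonneg _) hs.2
    linarith
  nlinarith

lemma integral_rect_combination {X : Type*} [MeasurableSpace X] {μ : Measure X} {a b c d : X → ℂ}
    (ha : Integrable a μ) (hb : Integrable b μ) (hc : Integrable c μ) (hd : Integrable d μ)
    (h : ∀ x, a x - b x + I • c x - I • d x = 0) :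
    (∫ x, a x ∂μ) - (∫ x, b x ∂μ) + I • (∫ x, c x ∂μ) - I • (∫ x, d x ∂μ) = 0 := by
  have e1 := integral_sub (f := fun x => a x - b x + I • c x) (g := fun x => I • d x)
    ((ha.sub hb).add (hc.smul I)) (hd.smul I)
  have e2 := integral_add (f := fun x => a x - b x) (g := fun x => I • c x) (ha.sub hb) (hc.smul I)
  rw [← integral_sub ha hb, ← integral_smul, ← integral_smul, ← e2, ← e1]
  simp only [h, integral_zero]

/-- The integral over `x + i β`, `x ∈ ℝⁿ`, of a holomorphic function with uniform exponential
decay does not change when `β` moves along a segment. -/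
theorem integral_complexLine_eq {n : ℕ} {U : Set (Fin n → ℂ)} {F : (Fin n → ℂ) → ℂ}
    (hF : DifferentiableOn ℂ F U) {β v : Fin n → ℝ}
    (hmem : ∀ t ∈ Set.Icc (0 : ℝ) 1, ∀ x : Fin n → ℝ,
      (fun i => (x i : ℂ) + I * ((β i + t * v i : ℝ) : ℂ)) ∈ U)
    {C ε : ℝ} (hε : 0 < ε)
    (hbound : ∀ t ∈ Set.Icc (0 : ℝ) 1, ∀ x : Fin n → ℝ,
      ‖F (fun i => (x i : ℂ) + I * ((β i + t * v i : ℝ) : ℂ))‖ ≤ C * Real.exp (-ε * ∑ i, |x i|)) :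
    ∫ x : Fin n → ℝ, F (fun i => (x i : ℂ) + I * ((β i + v i : ℝ) : ℂ)) =
      ∫ x : Fin n → ℝ, F (fun i => (x i : ℂ) + I * (β i : ℂ)) := by
  -- For fixed `x`, `s + i t ↦ P x s t` parametrizes a complex line in the direction `v`, so
  -- one-variable Cauchy theory on the unit square moves all coordinates at once.
  set P : (Fin n → ℝ) → ℝ → ℝ → (Fin n → ℂ) :=
    fun x s t i => ((x i + s * v i : ℝ) : ℂ) + I * ((β i + t * v i : ℝ) : ℂ) with hP
  have hPmem : ∀ x s t, t ∈ Set.Icc (0 : ℝ) 1 → P x s t ∈ U := fun x s t ht =>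
    hmem t ht fun i => x i + s * v i
  set G : ℝ → ℂ := fun t => ∫ x : Fin n → ℝ, F (fun i => (x i : ℂ) + I * ((β i + t * v i : ℝ) : ℂ))
    with hG
  -- The parameter `s` is a real translation and disappears after integration over `x`. The vertical
  -- sides of the square therefore cancel each other, and no limit of large rectangles is needed.
  have htrans : ∀ s t, ∫ x : Fin n → ℝ, F (P x s t) = G t := by
    intro s t
    have := integral_add_right_eq_self (μ := (volume : Measure (Fin n → ℝ)))
      (fun x : Fin n → ℝ => F (fun i => (x i : ℂ) + I * ((β i + t * v i : ℝ) : ℂ))) (s • v)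
    simpa [hP, hG] using this
  have hC : 0 ≤ C := by
    have := (norm_nonneg _).trans (hbound 0 ⟨le_rfl, zero_le_one⟩ 0)
    simpa using this
  have hint : ∀ (S T : ℝ → ℝ), Continuous S → Continuous T →
      (∀ r ∈ Set.Icc (0 : ℝ) 1, S r ∈ Set.Icc (0 : ℝ) 1 ∧ T r ∈ Set.Icc (0 : ℝ) 1) →
      Integrable (fun p : (Fin n → ℝ) × ℝ => F (P p.1 (S p.2) (T p.2)))
        (volume.prod (volume.restrict (Set.Ioc (0 : ℝ) 1))) := by
    intro S T hS hT hST
    have hg : Integrable (fun p : (Fin n → ℝ) × ℝ =>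
        (C * (Real.exp (ε * ∑ i, |v i|) * Real.exp (-ε * ∑ i, |p.1 i|))) * 1)
        (volume.prod (volume.restrict (Set.Ioc (0 : ℝ) 1))) :=
      (((integrable_exp_neg_sum_abs hε).const_mul _).const_mul C).mul_prod (integrable_const (1 : ℝ))
    have hprod : (volume : Measure (Fin n → ℝ)).prod (volume.restrict (Set.Ioc (0 : ℝ) 1)) =
        ((volume : Measure (Fin n → ℝ)).prod volume).restrict (Set.univ ×ˢ Set.Ioc (0 : ℝ) 1) := by
      rw [← Measure.prod_restrict, Measure.restrict_univ]
    have hms : MeasurableSet ((Set.univ : Set (Fin n → ℝ)) ×ˢ Set.Ioc (0 : ℝ) 1) :=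
      MeasurableSet.univ.prod measurableSet_Ioc
    refine hg.mono' ?_ ?_
    · rw [hprod]
      refine ContinuousOn.aestronglyMeasurable ?_ hms
      refine hF.continuousOn.comp ?_ fun p hp => hPmem _ _ _ (hST _ (Set.Ioc_subset_Icc_self hp.2)).2
      exact Continuous.continuousOn (by simp only [hP]; fun_prop)
    · rw [hprod, ae_restrict_iff' hms]
      refine .of_forall fun p hp => ?_
      have h := hST _ (Set.Ioc_subset_Icc_self hp.2)
      rw [mul_one]
      refine (hbound _ h.2 _).trans ?_
      gcongr
      exact exp_neg_sum_abs_add_le hε _ _ h.1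
  have hswap : ∀ (S T : ℝ → ℝ), Continuous S → Continuous T →
      (∀ r ∈ Set.Icc (0 : ℝ) 1, S r ∈ Set.Icc (0 : ℝ) 1 ∧ T r ∈ Set.Icc (0 : ℝ) 1) →
      Integrable (fun x => ∫ r in (0 : ℝ)..1, F (P x (S r) (T r))) ∧
      ∫ x : Fin n → ℝ, ∫ r in (0 : ℝ)..1, F (P x (S r) (T r)) = ∫ r in (0 : ℝ)..1, G (T r) := by
    intro S T hS hT hST
    have h := hint S T hS hT hST
    simp only [intervalIntegral.integral_of_le zero_le_one]
    refine ⟨h.integral_prod_left, ?_⟩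
    rw [integral_integral_swap h]
    simp only [htrans]
  have hrect : ∀ x, (∫ r in (0 : ℝ)..1, F (P x r 0)) - (∫ r in (0 : ℝ)..1, F (P x r 1)) +
      I • (∫ r in (0 : ℝ)..1, F (P x 1 r)) - I • (∫ r in (0 : ℝ)..1, F (P x 0 r)) = 0 := by
    intro x
    set L : ℂ → (Fin n → ℂ) := fun s i => (x i : ℂ) + I * (β i : ℂ) + s * (v i : ℂ) with hL
    have hLP : ∀ s t : ℝ, L (s + t * I) = P x s t := by
      intro s t
      ext i
      simp only [hL, hP]
      push_cast
      ring
    have h := integral_boundary_rect_eq_zero_of_differentiableOn (fun s => F (L s)) 0 (1 + I) ?_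
    · have e1 : ∀ r : ℝ, L (r + 1 * I) = P x r 1 := fun r => by
        rw [← hLP]; simp
      have e0 : ∀ r : ℝ, L (r + 0 * I) = P x r 0 := fun r => by
        rw [← hLP]; simp
      have e2 : ∀ r : ℝ, L (1 + r * I) = P x 1 r := fun r => by
        rw [← hLP]; simp
      have e3 : ∀ r : ℝ, L (0 + r * I) = P x 0 r := fun r => by
        rw [← hLP]; simp
      simpa only [add_re, add_im, one_re, one_im, I_re, I_im, zero_re, zero_im, add_zero, zero_add,
        ofReal_one, ofReal_zero, e0, e1, e2, ← e3] using h
    · have hLd : Differentiable ℂ L := by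
        rw [differentiable_pi]; intro i; simp only [hL]; fun_prop
      refine hF.comp hLd.differentiableOn fun s hs => ?_
      have := hPmem x s.re s.im (by simpa [mem_reProdIm] using hs.2)
      rw [← hLP, re_add_im] at this
      exact this
  obtain ⟨i1, s1⟩ := hswap id (fun _ => 0) continuous_id continuous_const (fun r hr => ⟨hr, by simp⟩)
  obtain ⟨i2, s2⟩ := hswap id (fun _ => 1) continuous_id continuous_const (fun r hr => ⟨hr, by simp⟩)
  obtain ⟨i3, s3⟩ := hswap (fun _ => 1) id continuous_const continuous_id (fun r hr => ⟨by simp, hr⟩)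
  obtain ⟨i4, s4⟩ := hswap (fun _ => 0) id continuous_const continuous_id (fun r hr => ⟨by simp, hr⟩)
  simp only [id] at *
  have := integral_rect_combination i1 i2 i3 i4 hrect
  rw [s1, s2, s3, s4] at this
  simp at this
  have h2 : G 1 = G 0 := by linear_combination -this
  simpa [hG] using h2

/-! ## Linear algebra of the gluing data -/

/-- Twice the inverse of `matB`. -/
def matBInvTwo : Matrix (Fin 15) (Fin 15) ℤ :=
  !![0, 0, 0, 0, 0, 0, 0, 0, 0, 0, 0, -2, 0, 0, 0;
     -1, 0, 0, 0, -1, -1, -1, 0, 0, 0, 0, 0, 0, 0, 0;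
     0, -1, 0, 0, -1, 0, 0, -1, -1, 0, 0, 0, 0, 0, 0;
     -1, 1, 0, 1, 0, -1, 0, 1, 0, -1, 0, 0, 0, 0, 0;
     -1, 1, 1, 1, 0, 0, 0, 0, 0, 0, 0, 0, 0, 0, 0;
     -1, 1, 1, 1, 0, 0, 0, 0, 0, 0, -2, 0, 0, 0, 0;
     1, -1, 0, 0, 0, -1, 1, -1, -1, 0, 0, 0, 0, -2, 0;
     1, -1, 0, 0, 0, -1, -1, -1, -1, 0, 0, 0, 0, -2, -2;
     0, 0, 1, 0, 0, -1, 0, -1, 0, -1, -2, 0, 0, -2, 0;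
     1, 0, 0, 0, 1, 1, 1, 0, 0, 0, 0, -2, 0, 0, 2;
     1, 0, 0, 0, -1, 1, 1, 0, 0, 0, 0, 0, -2, 0, 2;
     0, 0, 0, 1, 0, 0, 1, 0, 1, -1, 0, 0, 0, 0, 2;
     0, 0, 0, 0, 0, 0, 0, 0, 0, 0, 0, 0, 2, 0, 0;
     0, 1, 0, 0, 1, 0, 0, 1, 1, 0, 0, 0, 2, 2, 0;
     0, 1, -1, 0, 1, -1, 0, 0, 1, -1, 0, 0, 2, 0, 0]

-- An integer certificate that `B` is invertible. The bound on its entries then enters the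
-- comparison of norms in `sum_abs_le_of_realB`.
set_option maxRecDepth 100000 in
lemma matB_mul_matBInvTwo : matB * matBInvTwo = 2 := by decide +kernel

set_option maxRecDepth 100000 in
lemma abs_matBInvTwo_le : ∀ i j, |matBInvTwo i j| ≤ 2 := by decide +kernel

set_option maxRecDepth 100000 in
lemma matABt_transpose : matABt.transpose = matABt := by decide +kernel

lemma bijective_octIdx : Function.Bijective (fun p : Fin 5 × Fin 3 => octIdx p.1 p.2) := by
  decide +kernel

lemma sum_octIdx {M : Type*} [AddCommMonoid M] (f : Fin 15 → M) :
    ∑ a : Fin 5, ∑ i : Fin 3, f (octIdx a i) = ∑ j, f j := by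
  rw [← Fintype.sum_prod_type' (f := fun a i => f (octIdx a i))]
  exact Fintype.sum_bijective _ bijective_octIdx _ _ fun _ => rfl

/-- Real form of `matB`. -/
abbrev realB : Matrix (Fin 15) (Fin 15) ℝ := matB.map (Int.cast : ℤ → ℝ)

/-- Real form of `matABt`. -/
abbrev realABt : Matrix (Fin 15) (Fin 15) ℝ := matABt.map (Int.cast : ℤ → ℝ)

lemma realB_mul : realB * matBInvTwo.map (Int.cast : ℤ → ℝ) = 2 := by
  have h := congrArg (fun M : Matrix (Fin 15) (Fin 15) ℤ => M.map (Int.castRingHom ℝ))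
    matB_mul_matBInvTwo
  simp only [Matrix.map_mul] at h
  refine h.trans ?_
  ext i j
  simp [Matrix.ofNat_apply]

lemma isUnit_det_realB : IsUnit realB.det := by
  refine Matrix.isUnit_det_of_right_inverse (B := (1 / 2 : ℝ) • matBInvTwo.map (Int.cast : ℤ → ℝ)) ?_
  rw [Matrix.mul_smul, realB_mul]
  ext i j
  by_cases h : i = j <;> simp [Matrix.ofNat_apply, Matrix.one_apply, h]

lemma realABt_transpose : realABt.transpose = realABt := by
  rw [realABt, ← Matrix.transpose_map, matABt_transpose]

/-- With `y = -Bᵀ x` one has `2 x = -(2 B⁻¹)ᵀ y`, and the entries of `2 B⁻¹` are at most `2` in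
absolute value, so each `|xᵢ|` is at most `∑ |yⱼ|`; the factor `15` counts coordinates. This
transfers decay in the octahedron arguments to the integration variables. -/
lemma sum_abs_le_of_realB (x : Fin 15 → ℝ) :
    ∑ i, |x i| ≤ 15 * ∑ j, |(-realB.transpose).mulVec x j| := by
  set C : Matrix (Fin 15) (Fin 15) ℝ := matBInvTwo.map (Int.cast : ℤ → ℝ) with hC
  set y := (-realB.transpose).mulVec x with hy
  have h1 : (-C.transpose).mulVec y = (2 : ℝ) • x := by
    have : C.transpose * realB.transpose = 2 := by
      rw [← Matrix.transpose_mul, realB_mul, Matrix.transpose_ofNat]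
    rw [hy, Matrix.mulVec_mulVec, neg_mul_neg, this]
    ext i
    simp [Matrix.ofNat_mulVec]
  have h2 : ∀ i, |x i| ≤ ∑ j, |y j| := by
    intro i
    have h3 : 2 * x i = ∑ j, -C j i * y j := by
      have := congrFun h1 i
      simpa [Matrix.mulVec, dotProduct] using this.symm
    have h4 : 2 * |x i| ≤ 2 * ∑ j, |y j| := by
      calc 2 * |x i| = |2 * x i| := by rw [abs_mul, abs_two]
        _ = |∑ j, -C j i * y j| := by rw [h3]
        _ ≤ ∑ j, |-C j i * y j| := Finset.abs_sum_le_sum_abs _ _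
        _ ≤ ∑ j, 2 * |y j| := by
          refine Finset.sum_le_sum fun j _ => ?_
          rw [abs_mul, abs_neg]
          gcongr
          have := abs_matBInvTwo_le j i
          simp only [hC, Matrix.map_apply]
          exact_mod_cast this
        _ = _ := by rw [Finset.mul_sum]
    linarith
  calc ∑ i, |x i| ≤ ∑ _i : Fin 15, ∑ j, |y j| := Finset.sum_le_sum fun i _ => h2 i
    _ = _ := by simp

lemma complexPt_eq (M : Matrix (Fin 15) (Fin 15) ℤ) (x β : Fin 15 → ℝ) :
    (M.map (Int.cast : ℤ → ℂ)).mulVec (complexPt x β) =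
      complexPt ((M.map (Int.cast : ℤ → ℝ)).mulVec x) ((M.map (Int.cast : ℤ → ℝ)).mulVec β) := by
  ext i
  simp only [complexPt, Matrix.mulVec, dotProduct, Matrix.map_apply, ofReal_sum, ofReal_mul,
    ofReal_intCast, Finset.mul_sum, ← Finset.sum_add_distrib]
  exact Finset.sum_congr rfl fun j _ => by ring

lemma neg_transpose_matB_mulVec (x β : Fin 15 → ℝ) :
    (-(matB.map (Int.cast : ℤ → ℂ)).transpose).mulVec (complexPt x β) =
      complexPt ((-realB.transpose).mulVec x) ((-realB.transpose).mulVec β) := by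
  have := complexPt_eq (-matB.transpose) x β
  have hc : ∀ {R : Type} [Ring R], (-matB.transpose).map (Int.cast : ℤ → R) =
      -(matB.map (Int.cast : ℤ → R)).transpose := by
    intro R _
    ext i j
    simp
  rwa [hc, hc] at this

/-- Symmetry of `A Bᵀ` merges the two cross terms. The quadratic exponential thus has a modulus with
exponent linear in `x`. -/
lemma im_quadratic_complexPt (x β : Fin 15 → ℝ) :
    (dotProduct (complexPt x β) ((matABt.map (Int.cast : ℤ → ℂ)).mulVec (complexPt x β))).im =
      2 * dotProduct x (realABt.mulVec β) := by
  rw [complexPt_eq]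
  have h : dotProduct β (realABt.mulVec x) = dotProduct x (realABt.mulVec β) := by
    rw [Matrix.dotProduct_mulVec, ← Matrix.mulVec_transpose, realABt_transpose, dotProduct_comm]
  have h2 : (dotProduct (complexPt x β) (complexPt (realABt.mulVec x) (realABt.mulVec β))).im =
      dotProduct x (realABt.mulVec β) + dotProduct β (realABt.mulVec x) := by
    simp only [dotProduct, complexPt, im_sum, ← Finset.sum_add_distrib]
    exact Finset.sum_congr rfl fun i _ => by simp
  rw [h2, h]; ring

/-! ## Margins of angle structures -/

/-- Membership in the product of five octahedron polytopes, with a margin `ε`. -/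
def FiveMargin (b : ℂ) (ε : ℝ) (α β : Fin 15 → ℝ) : Prop :=
  ∀ a, OctMargin b ε (fun i => α (octIdx a i)) (fun i => β (octIdx a i))

/-- Finitely many strict inequalities leave room. The form with all small `ε` lets two angle
structures share one margin. -/
lemma eventually_fiveMargin {b : ℂ} {p : AngleSpace} (hp : p ∈ polytopeFiveOct b) :
    ∀ᶠ ε in 𝓝[>] (0 : ℝ), FiveMargin b ε p.1 p.2 := by
  have hd : ∀ {u v : ℝ}, u < v → ∀ᶠ ε in 𝓝[>] (0 : ℝ), ε ≤ v - u := fun h =>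
    nhdsWithin_le_nhds (Iic_mem_nhds (sub_pos.2 h))
  simp only [FiveMargin, eventually_all]
  intro a
  obtain ⟨h1, h2, h3, h4, h5⟩ := hp a
  filter_upwards [eventually_all.2 fun i => hd (h1 i), hd h2, eventually_all.2 fun i => hd (h3 i),
    eventually_all.2 fun i => hd (h4 i),
    eventually_all.2 fun i => eventually_all.2 fun j => eventually_all.2 fun hij => hd (h5 i j hij)]
    with ε e1 e2 e3 e4 e5
  exact ⟨fun i => by linarith [e1 i], by linarith, fun i => by linarith [e3 i],
    fun i => by linarith [e4 i], fun i j hij => by linarith [e5 i j hij]⟩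

lemma OctMargin.convex {b : ℂ} {ε : ℝ} {α β α' β' : Fin 3 → ℝ} (h : OctMargin b ε α β)
    (h' : OctMargin b ε α' β') {t : ℝ} (ht : t ∈ Set.Icc (0 : ℝ) 1) :
    OctMargin b ε (fun i => α i + t * (α' i - α i)) (fun i => β i + t * (β' i - β i)) := by
  have key : ∀ {u u' v : ℝ}, u ≤ v → u' ≤ v → u + t * (u' - u) ≤ v := by
    intro u u' v h1 h2
    nlinarith [mul_le_mul_of_nonneg_left h1 (sub_nonneg.2 ht.2), mul_le_mul_of_nonneg_left h2 ht.1]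
  have hs : ∑ i, (α i + t * (α' i - α i)) = (∑ i, α i) + t * ((∑ i, α' i) - ∑ i, α i) := by
    rw [Finset.sum_add_distrib, ← Finset.mul_sum, Finset.sum_sub_distrib]
  refine ⟨fun i => ?_, ?_, fun i => ?_, fun i => ?_, fun i j hij => ?_⟩
  · linarith [key (neg_le_neg (h.pos i)) (neg_le_neg (h'.pos i))]
  · rw [hs]
    linarith [key h.sum_le h'.sum_le]
  · linarith [key (h.neg_ray i) (h'.neg_ray i)]
  · rw [hs]
    linarith [key (neg_le_neg (h.pos_ray i)) (neg_le_neg (h'.pos_ray i))]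
  · linarith [key (h.diff_ray i j hij) (h'.diff_ray i j hij)]

/-- The angle structures of the five octahedra above a point of `polytopeNew`. -/
lemma exists_of_mem_polytopeNew {b : ℂ} {α β : Fin 15 → ℝ} (h : (α, β) ∈ polytopeNew b) :
    ∃ β₀ : Fin 15 → ℝ, ((-realB.transpose).mulVec β, β₀) ∈ polytopeFiveOct b ∧
      ∀ i, realB.mulVec β₀ i = α i - Qb b / 2 * vecT i + realABt.mulVec β i := by
  -- Inverting the four maps: `β = -(B⁻¹)ᵀ α₀` and `α - (Q/2) t = B β₀ - A Bᵀ β`.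
  obtain ⟨⟨α₀, β₀⟩, hp, he⟩ := h
  simp only [angleShift, angleS, angleT, angleU, Prod.mk.injEq] at he
  obtain ⟨h1, h2⟩ := he
  refine ⟨β₀, ?_, fun i => ?_⟩
  · have : (-realB.transpose).mulVec β = α₀ := by
      rw [← h2, Matrix.mulVec_mulVec, neg_mul_neg, ← Matrix.transpose_mul,
        Matrix.nonsing_inv_mul _ isUnit_det_realB]
      simp
    rwa [this]
  · rw [h2] at h1
    have := congrFun h1 i
    simp only [Pi.neg_apply, Pi.add_apply, Matrix.neg_mulVec] at this
    rw [← this]; ring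

/-! ## The state integral -/

/-- The integrand of the state integral as a function on `ℂ¹⁵`. -/
def stateFn (k : ℕ) (b : ℂ) (σ : Fin 15 → ℂ) (m n : Fin 15 → ZMod k) (ν : Fin 15 → ℂ) : ℂ :=
  exp (2 * Real.pi * I / k * (-(∑ i, σ i * ν i) + ∑ i, ((m i).val : ℂ) * ((n i).val : ℂ))) *
    actT (actU (Zprod k b)) ν n

lemma stateIntegrand_eq (k : ℕ) (b : ℂ) (β : Fin 15 → ℝ) (μ : Fin 15 → ℂ) (m n : Fin 15 → ZMod k)
    (x : Fin 15 → ℝ) :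
    stateIntegrand k b β μ m n x = stateFn k b (shiftArg b μ) m n (complexPt x β) := rfl

lemma partitionFn_eq (k : ℕ) [NeZero k] (b : ℂ) (β : Fin 15 → ℝ) (μ : Fin 15 → ℂ)
    (m : Fin 15 → ZMod k) :
    partitionFn k b β μ m = 1 / (k : ℂ) ^ 15 * ∑ n : Fin 15 → ZMod k,
      ∫ x : Fin 15 → ℝ, stateFn k b (shiftArg b μ) m n (complexPt x β) := rfl

/-- The arguments of the octahedron functions. -/
def octArg (ν : Fin 15 → ℂ) : Fin 15 → ℂ := (-(matB.map (Int.cast : ℤ → ℂ)).transpose).mulVec ν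

lemma octArg_complexPt (x β : Fin 15 → ℝ) :
    octArg (complexPt x β) =
      complexPt ((-realB.transpose).mulVec x) ((-realB.transpose).mulVec β) :=
  neg_transpose_matB_mulVec x β

lemma complexPt_re (x β : Fin 15 → ℝ) (i : Fin 15) : (complexPt x β i).re = x i := by
  simp [complexPt]

lemma complexPt_im (x β : Fin 15 → ℝ) (i : Fin 15) : (complexPt x β i).im = β i := by
  simp [complexPt]

/-- The domain in which the integrand of the state integral is holomorphic. -/
def stateDomain (b : ℂ) : Set (Fin 15 → ℂ) :=
  {ν | ∀ a, (∀ i, 0 < (octArg ν (octIdx a i)).im) ∧ ∑ i, (octArg ν (octIdx a i)).im < Qb b}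

lemma complexPt_mem_stateDomain {b : ℂ} {ε : ℝ} (hε : 0 < ε) {β β₀ : Fin 15 → ℝ}
    (h : FiveMargin b ε ((-realB.transpose).mulVec β) β₀) (x : Fin 15 → ℝ) :
    complexPt x β ∈ stateDomain b := by
  intro a
  simp only [octArg_complexPt, complexPt_im]
  exact ⟨fun i => hε.trans_le ((h a).pos i), by linarith [(h a).sum_le]⟩

lemma sum_complexPt_mul_im (σ : Fin 15 → ℂ) (x β : Fin 15 → ℝ) :
    (∑ i, σ i * complexPt x β i).im = ∑ i, (σ i).re * β i + ∑ i, (σ i).im * x i := by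
  rw [im_sum, ← Finset.sum_add_distrib]
  exact Finset.sum_congr rfl fun i _ => by rw [mul_im, complexPt_re, complexPt_im]

/-- On the contour the exponent linear in `x` is `Im σ · x + x · A Bᵀ β`. By `h` it equals `x · B
β₀`, which is minus the pairing of `β₀` with the real parts of the octahedron arguments, so it
splits into the damping factors of the five octahedra. Only `exp ((2π/k) Re σ · β)` remains. -/
lemma norm_stateFn {k : ℕ} {b : ℂ} (σ : Fin 15 → ℂ) (m n : Fin 15 → ZMod k) (x β β₀ : Fin 15 → ℝ)
    (h : ∀ i, realB.mulVec β₀ i = (σ i).im + realABt.mulVec β i) :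
    ‖stateFn k b σ m n (complexPt x β)‖ =
      ‖(((-matB).det : ℤ) : ℂ) ^ (1 / 2 : ℂ)‖ * Real.exp (2 * Real.pi / k * ∑ i, (σ i).re * β i) *
        ∏ a : Fin 5, (Real.exp (-(2 * Real.pi / k) *
          ∑ i, β₀ (octIdx a i) * (octArg (complexPt x β) (octIdx a i)).re) *
          ‖Zoct k b (fun i => octArg (complexPt x β) (octIdx a i))
            (fun i => (-(matB.map (Int.cast : ℤ → ZMod k)).transpose).mulVec n (octIdx a i))‖) := by
  have e1 : ‖exp (2 * Real.pi * I / k * (-(∑ i, σ i * complexPt x β i) +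
      ∑ i, ((m i).val : ℂ) * ((n i).val : ℂ)))‖ =
      Real.exp (2 * Real.pi / k * (∑ i, (σ i).re * β i + ∑ i, (σ i).im * x i)) := by
    rw [norm_exp_mul_two_pi_I_div, add_im, neg_im, sum_complexPt_mul_im]
    have : (∑ i, ((m i).val : ℂ) * ((n i).val : ℂ)).im = 0 := by
      rw [im_sum]; exact Finset.sum_eq_zero fun i _ => by
        rw [mul_im, natCast_im, natCast_im, mul_zero, zero_mul, add_zero]
    rw [this]
    congr 1; ring
  have e2 : ‖exp (I * Real.pi / k * (-(dotProduct (complexPt x β)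
      ((matABt.map (Int.cast : ℤ → ℂ)).mulVec (complexPt x β))) + (quadABt n : ℂ)))‖ =
      Real.exp (2 * Real.pi / k * dotProduct x (realABt.mulVec β)) := by
    have : ∀ w : ℂ, (I * Real.pi / k * w : ℂ) = 2 * Real.pi * I / k * (w / 2) := fun w => by ring
    rw [this, norm_exp_mul_two_pi_I_div, div_ofNat_im, add_im, neg_im, im_quadratic_complexPt,
      intCast_im]
    congr 1; ring
  have e3 : ∑ i, (σ i).im * x i + dotProduct x (realABt.mulVec β) =
      -∑ j, β₀ j * (octArg (complexPt x β) j).re := by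
    have : ∑ i, (σ i).im * x i + dotProduct x (realABt.mulVec β) =
        dotProduct x (realB.mulVec β₀) := by
      simp only [dotProduct, h, ← Finset.sum_add_distrib]
      exact Finset.sum_congr rfl fun i _ => by ring
    rw [this, Matrix.dotProduct_mulVec, ← Matrix.mulVec_transpose]
    simp only [octArg_complexPt, complexPt_re, Matrix.neg_mulVec, Pi.neg_apply, dotProduct, mul_neg,
      Finset.sum_neg_distrib, neg_neg]
    exact Finset.sum_congr rfl fun i _ => by ring
  have e4 : Real.exp (2 * Real.pi / k * (∑ i, (σ i).re * β i + ∑ i, (σ i).im * x i)) *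
      Real.exp (2 * Real.pi / k * dotProduct x (realABt.mulVec β)) =
      Real.exp (2 * Real.pi / k * ∑ i, (σ i).re * β i) *
        ∏ a : Fin 5, Real.exp (-(2 * Real.pi / k) *
          ∑ i, β₀ (octIdx a i) * (octArg (complexPt x β) (octIdx a i)).re) := by
    rw [← Real.exp_sum, ← Finset.mul_sum,
      sum_octIdx (fun j => β₀ j * (octArg (complexPt x β) j).re), ← Real.exp_add, ← Real.exp_add]
    congr 1
    linear_combination (2 * Real.pi / k) * e3
  rw [stateFn, actT, actU, Zprod, norm_mul, norm_mul, norm_mul, norm_mul, e1, e2, norm_zpow, norm_neg,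
    norm_one, one_zpow, one_mul, norm_prod, Finset.prod_mul_distrib, ← octArg]
  linear_combination (‖(((-matB).det : ℤ) : ℂ) ^ (1 / 2 : ℂ)‖ * ∏ a : Fin 5,
    ‖Zoct k b (fun i => octArg (complexPt x β) (octIdx a i))
      (fun i => (-(matB.map (Int.cast : ℤ → ZMod k)).transpose).mulVec n (octIdx a i))‖) * e4

section

variable {k : ℕ} [NeZero k] {b : ℂ}

lemma differentiableOn_stateFn (hb : ‖b‖ = 1) (hre : 0 < b.re) (him : b.im ≠ 0) (σ : Fin 15 → ℂ)
    (m n : Fin 15 → ZMod k) : DifferentiableOn ℂ (stateFn k b σ m n) (stateDomain b) := by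
  intro ν hν
  apply DifferentiableAt.differentiableWithinAt
  have hoct : Differentiable ℂ octArg := by
    unfold octArg Matrix.mulVec dotProduct
    fun_prop
  have h1 : DifferentiableAt ℂ (fun ν => Zprod k b (octArg ν)
      ((-(matB.map (Int.cast : ℤ → ZMod k)).transpose).mulVec n)) ν := by
    unfold Zprod
    have h2 := fun a : Fin 5 => differentiableAt_Zoct (k := k) hb hre him
      (fun i => (-(matB.map (Int.cast : ℤ → ZMod k)).transpose).mulVec n (octIdx a i))
      (μ := fun ν i => octArg ν (octIdx a i))
      (fun i => (differentiable_pi.1 hoct _).differentiableAt) (hν a).1 (hν a).2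
    simp only [Fin.prod_univ_five]
    exact ((((h2 0).mul (h2 1)).mul (h2 2)).mul (h2 3)).mul (h2 4)
  unfold stateFn actT actU
  refine DifferentiableAt.mul (by fun_prop) (DifferentiableAt.mul ?_ (h1.const_mul _))
  unfold Matrix.mulVec dotProduct
  fun_prop

/-- The rate `δ` carries `ε / 2` from the octahedra and `1 / 15` from inverting `B`. Both constants
are independent of `σ`, `β` and `β₀`, as is needed along a family of contours. -/
lemma exists_norm_stateFn_le (hb : ‖b‖ = 1) (hre : 0 < b.re) (him : b.im ≠ 0) {ε : ℝ}
    (hε : 0 < ε) :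
    ∃ C δ : ℝ, 0 ≤ C ∧ 0 < δ ∧ ∀ (σ : Fin 15 → ℂ) (m n : Fin 15 → ZMod k) (x β β₀ : Fin 15 → ℝ),
      FiveMargin b ε ((-realB.transpose).mulVec β) β₀ →
      (∀ i, realB.mulVec β₀ i = (σ i).im + realABt.mulVec β i) →
      ‖stateFn k b σ m n (complexPt x β)‖ ≤
        C * Real.exp (2 * Real.pi / k * ∑ i, (σ i).re * β i) * Real.exp (-δ * ∑ i, |x i|) := by
  obtain ⟨C, hC, hoct⟩ := exists_norm_Zoct_le (k := k) hb hre him hε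
  have hκ := two_pi_div_pos k
  refine ⟨‖(((-matB).det : ℤ) : ℂ) ^ (1 / 2 : ℂ)‖ * C ^ 5, 2 * Real.pi / k * (ε / 2) / 15,
    by positivity, by positivity, fun σ m n x β β₀ hM h => ?_⟩
  rw [norm_stateFn σ m n x β β₀ h]
  have h1 : ∀ a : Fin 5, Real.exp (-(2 * Real.pi / k) *
      ∑ i, β₀ (octIdx a i) * (octArg (complexPt x β) (octIdx a i)).re) *
      ‖Zoct k b (fun i => octArg (complexPt x β) (octIdx a i))
        (fun i => (-(matB.map (Int.cast : ℤ → ZMod k)).transpose).mulVec n (octIdx a i))‖ ≤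
      C * Real.exp (-(2 * Real.pi / k * (ε / 2)) *
        ∑ i, |(octArg (complexPt x β) (octIdx a i)).re|) := by
    intro a
    refine hoct _ (fun i => octArg (complexPt x β) (octIdx a i)) (fun i => β₀ (octIdx a i)) ?_
    simpa only [octArg_complexPt, complexPt_im] using hM a
  have h2 := Finset.prod_le_prod (s := Finset.univ) (fun a _ => by positivity) fun a _ => h1 a
  have h5 : ∏ a : Fin 5, (C * Real.exp (-(2 * Real.pi / k * (ε / 2)) *
      ∑ i, |(octArg (complexPt x β) (octIdx a i)).re|)) =
      C ^ 5 * Real.exp (-(2 * Real.pi / k * (ε / 2)) * ∑ j, |(octArg (complexPt x β) j).re|) := by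
    rw [Finset.prod_mul_distrib, ← Real.exp_sum, ← Finset.mul_sum,
      sum_octIdx (fun j => |(octArg (complexPt x β) j).re|), Finset.prod_const, Finset.card_univ,
      Fintype.card_fin]
  rw [h5] at h2
  have h3 : Real.exp (-(2 * Real.pi / k * (ε / 2)) * ∑ j, |(octArg (complexPt x β) j).re|) ≤
      Real.exp (-(2 * Real.pi / k * (ε / 2) / 15) * ∑ i, |x i|) := by
    rw [Real.exp_le_exp]
    have := sum_abs_le_of_realB x
    simp only [octArg_complexPt, complexPt_re]
    have h4 : 0 ≤ 2 * Real.pi / k * (ε / 2) / 15 := by positivity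
    have := mul_le_mul_of_nonneg_left this h4
    linarith
  calc _ ≤ ‖(((-matB).det : ℤ) : ℂ) ^ (1 / 2 : ℂ)‖ *
        Real.exp (2 * Real.pi / k * ∑ i, (σ i).re * β i) *
        (C ^ 5 * Real.exp (-(2 * Real.pi / k * (ε / 2)) *
          ∑ j, |(octArg (complexPt x β) j).re|)) := by gcongr
    _ ≤ ‖(((-matB).det : ℤ) : ℂ) ^ (1 / 2 : ℂ)‖ *
        Real.exp (2 * Real.pi / k * ∑ i, (σ i).re * β i) *
        (C ^ 5 * Real.exp (-(2 * Real.pi / k * (ε / 2) / 15) * ∑ i, |x i|)) := by gcongr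
    _ = _ := by ring

lemma continuous_stateFn_complexPt (hb : ‖b‖ = 1) (hre : 0 < b.re) (him : b.im ≠ 0) {ε : ℝ}
    (hε : 0 < ε) {β β₀ : Fin 15 → ℝ} (h : FiveMargin b ε ((-realB.transpose).mulVec β) β₀)
    (σ : Fin 15 → ℂ) (m n : Fin 15 → ZMod k) :
    Continuous fun x => stateFn k b σ m n (complexPt x β) :=
  (differentiableOn_stateFn hb hre him σ m n).continuousOn.comp_continuous
    (by unfold complexPt; fun_prop) (complexPt_mem_stateDomain hε h)

lemma shiftArg_complexPt_im (x α : Fin 15 → ℝ) (i : Fin 15) :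
    (shiftArg b (complexPt x α) i).im = α i - Qb b / 2 * vecT i := by
  have : shiftArg b (complexPt x α) i = x i + I * ((α i - Qb b / 2 * vecT i : ℝ) : ℂ) := by
    simp only [shiftArg, complexPt]
    push_cast
    ring
  rw [this]; simp

lemma shiftArg_complexPt_re (x α : Fin 15 → ℝ) (i : Fin 15) :
    (shiftArg b (complexPt x α) i).re = x i := by
  have : shiftArg b (complexPt x α) i = x i + I * ((α i - Qb b / 2 * vecT i : ℝ) : ℂ) := by
    simp only [shiftArg, complexPt]
    push_cast
    ring
  rw [this]; simp

/-- Exponential decay of the integrand of the state integral. -/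
lemma exists_norm_stateIntegrand_le (hb : ‖b‖ = 1) (hre : 0 < b.re) (him : b.im ≠ 0)
    {α β : Fin 15 → ℝ} (h : (α, β) ∈ polytopeNew b) :
    (∀ (σ : Fin 15 → ℂ) (m n : Fin 15 → ZMod k),
      Continuous fun x => stateFn k b σ m n (complexPt x β)) ∧
    ∃ C δ : ℝ, 0 ≤ C ∧ 0 < δ ∧ ∀ (x : Fin 15 → ℝ) (m n : Fin 15 → ZMod k) (y : Fin 15 → ℝ),
      ‖stateIntegrand k b β (complexPt x α) m n y‖ ≤
        C * Real.exp (2 * Real.pi / k * ∑ i, x i * β i) * Real.exp (-δ * ∑ i, |y i|) := by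
  obtain ⟨β₀, hp, hβ⟩ := exists_of_mem_polytopeNew h
  obtain ⟨ε, hM, hε⟩ := ((eventually_fiveMargin hp).and self_mem_nhdsWithin).exists
  refine ⟨fun σ m n => continuous_stateFn_complexPt hb hre him hε hM σ m n, ?_⟩
  obtain ⟨C, δ, hC, hδ, hbound⟩ := exists_norm_stateFn_le (k := k) hb hre him hε
  refine ⟨C, δ, hC, hδ, fun x m n y => ?_⟩
  have := hbound (shiftArg b (complexPt x α)) m n y β β₀ hM fun i => by
    rw [shiftArg_complexPt_im, hβ]
  rw [stateIntegrand_eq]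
  simpa only [shiftArg_complexPt_re] using this

lemma integrable_stateIntegrand (hb : ‖b‖ = 1) (hre : 0 < b.re) (him : b.im ≠ 0)
    {α β : Fin 15 → ℝ} (h : (α, β) ∈ polytopeNew b) (x : Fin 15 → ℝ) (m n : Fin 15 → ZMod k) :
    Integrable (stateIntegrand k b β (complexPt x α) m n) := by
  obtain ⟨hc, C, δ, hC, hδ, hbound⟩ := exists_norm_stateIntegrand_le (k := k) hb hre him h
  exact ((integrable_exp_neg_sum_abs hδ).const_mul _).mono' (hc _ m n).aestronglyMeasurable
    (.of_forall fun y => hbound x m n y)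

/-- The angles `β` and `β₀` are interpolated linearly with `α` fixed. The margins survive by
convexity and the relation between `β` and `β₀` because it is affine, so the decay is uniform along
the segment and the contour can be moved. -/
lemma partitionFn_contour_independent (hb : ‖b‖ = 1) (hre : 0 < b.re) (him : b.im ≠ 0)
    {α β β' : Fin 15 → ℝ} (h : (α, β) ∈ polytopeNew b) (h' : (α, β') ∈ polytopeNew b)
    (x : Fin 15 → ℝ) (m : Fin 15 → ZMod k) :
    partitionFn k b β' (complexPt x α) m = partitionFn k b β (complexPt x α) m := by
  obtain ⟨β₀, hp, hβ⟩ := exists_of_mem_polytopeNew h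
  obtain ⟨β₀', hp', hβ'⟩ := exists_of_mem_polytopeNew h'
  obtain ⟨ε, ⟨hM, hM'⟩, hε⟩ :=
    (((eventually_fiveMargin hp).and (eventually_fiveMargin hp')).and self_mem_nhdsWithin).exists
  obtain ⟨C, δ, hC, hδ, hbound⟩ := exists_norm_stateFn_le (k := k) hb hre him hε
  set σ := shiftArg b (complexPt x α) with hσ
  set v : Fin 15 → ℝ := fun i => β' i - β i with hv
  have hlin : ∀ (M : Matrix (Fin 15) (Fin 15) ℝ) (u u' : Fin 15 → ℝ) (t : ℝ) (i : Fin 15),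
      M.mulVec (fun i => u i + t * (u' i - u i)) i =
        M.mulVec u i + t * (M.mulVec u' i - M.mulVec u i) := by
    intro M u u' t i
    have : (fun i => u i + t * (u' i - u i)) = u + t • (u' - u) := by ext; simp
    rw [this, Matrix.mulVec_add, Matrix.mulVec_smul, Matrix.mulVec_sub]
    simp
  have hMt : ∀ t ∈ Set.Icc (0 : ℝ) 1,
      FiveMargin b ε ((-realB.transpose).mulVec fun i => β i + t * v i)
        (fun i => β₀ i + t * (β₀' i - β₀ i)) := by
    intro t ht a
    simp only [hv, hlin]
    exact (hM a).convex (hM' a) ht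
  have hpt : ∀ (t : ℝ) (y : Fin 15 → ℝ),
      (fun i => (y i : ℂ) + I * ((β i + t * v i : ℝ) : ℂ)) = complexPt y fun i => β i + t * v i :=
    fun t y => rfl
  set S : ℝ → ℝ := fun t => ∑ i, (σ i).re * (β i + t * v i) with hS
  -- The only factor of the bound that varies with `t` is continuous on `[0, 1]`, hence bounded
  -- there.
  obtain ⟨D, hD⟩ := (isCompact_Icc (a := (0 : ℝ)) (b := 1)).exists_bound_of_continuousOn
    (f := fun t => Real.exp (2 * Real.pi / k * S t)) (Continuous.continuousOn (by
      simp only [hS]; fun_prop))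
  rw [partitionFn_eq, partitionFn_eq]
  congr 1
  refine Finset.sum_congr rfl fun n _ => ?_
  have key := integral_complexLine_eq (U := stateDomain b) (F := stateFn k b σ m n)
    (differentiableOn_stateFn hb hre him σ m n) (β := β) (v := v)
    (fun t ht y => by rw [hpt]; exact complexPt_mem_stateDomain hε (hMt t ht) y)
    (C := C * D) hδ (fun t ht y => by
      rw [hpt]
      refine (hbound σ m n y _ _ (hMt t ht) fun i => ?_).trans ?_
      · rw [hlin, hβ, hβ', hσ, shiftArg_complexPt_im]
        simp only [hv, hlin]
        ring
      · have := (le_abs_self _).trans (hD t ht)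
        simp only [hS] at this
        gcongr)
  have e1 : (fun i => β i + v i) = β' := by ext i; simp [hv]
  have e2 : ∀ y : Fin 15 → ℝ, (fun i => (y i : ℂ) + I * ((β i + v i : ℝ) : ℂ)) = complexPt y β' := by
    intro y; rw [← e1]; rfl
  simp only [e2] at key
  exact key

end

/-! ## Coherent states -/

/-- Completing the square: with `c = k Re z / (π √2)` the prefactor is `exp (-(2π/k) β c)`, which
cancels the cross term that would make the height depend on `z`. -/
lemma norm_coherentPsi_mul (k : ℕ) [NeZero k] (β : ℝ) (z : ℂ) (μ : ℝ) :
    Real.exp (2 * Real.pi / k * (μ * β)) * ‖coherentPsi k β z μ‖ =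
      (2 / k : ℝ) ^ (1 / 4 : ℝ) * Real.exp (Real.pi / k * β ^ 2) *
        Real.exp (-(Real.pi / k) * (μ - (k / (Real.pi * √2) * z.re + β)) ^ 2) := by
  have hN : 0 ≤ (2 / k : ℝ) ^ (1 / 4 : ℝ) := by positivity
  have hk : (k : ℝ) ≠ 0 := NeZero.ne _
  have hpi := Real.pi_ne_zero
  have h1 : ‖exp (I * (√2 * μ * z.im : ℝ))‖ = 1 := by rw [mul_comm, norm_exp_ofReal_mul_I]
  rw [coherentPsi, coherentNormalized, norm_mul, norm_mul, h1, norm_real, norm_real,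
    Real.norm_of_nonneg (Real.exp_pos _).le, Real.norm_of_nonneg (by positivity), mul_one]
  have h2 : √2 * √2 = 2 := Real.mul_self_sqrt (by norm_num)
  have h2' : √2 ≠ 0 := by positivity
  set c := k / (Real.pi * √2) * z.re with hc
  have h3 : √2 * z.re = 2 * Real.pi / k * c := by
    rw [hc]
    field_simp
    linear_combination z.re * h2
  have h4 : Real.exp (2 * Real.pi / k * (μ * β)) * Real.exp (-√2 * β * z.re) *
      Real.exp (-(Real.pi / k) * (μ - c) ^ 2) =
      Real.exp (Real.pi / k * β ^ 2) * Real.exp (-(Real.pi / k) * (μ - (c + β)) ^ 2) := by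
    simp only [← Real.exp_add]
    congr 1
    linear_combination -β * h3
  linear_combination ((2 / k : ℝ) ^ (1 / 4 : ℝ)) * h4

lemma continuous_coherentPsi (k : ℕ) (β : ℝ) (z : ℂ) : Continuous (coherentPsi k β z) := by
  unfold coherentPsi coherentNormalized
  fun_prop

lemma summable_exp_neg_mul_sq_int {c : ℝ} (hc : 0 < c) :
    Summable fun n : ℤ => Real.exp (-c * (n : ℝ) ^ 2) := by
  have h : Summable fun n : ℕ => Real.exp (-c * ((n : ℤ) : ℝ) ^ 2) := by
    refine Summable.of_nonneg_of_le (fun n => (Real.exp_pos _).le) (fun n => ?_)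
      (summable_geometric_of_lt_one (Real.exp_pos (-c)).le (Real.exp_lt_one_iff.2 (by linarith)))
    rw [← Real.exp_nat_mul, Real.exp_le_exp]
    have : (n : ℝ) ≤ (n : ℝ) ^ 2 := by exact_mod_cast Nat.le_self_pow two_ne_zero n
    push_cast
    nlinarith
  exact Summable.of_nat_of_neg h (by simpa using h)

/-- The phases, and with them `y`, drop out of the modulus. What is left is a theta series whose
centre `w` satisfies `|w| ≤ 1`, so one Gaussian series dominates all of them. -/
lemma exists_norm_coherentXi_le (k : ℕ) [NeZero k] :
    ∃ M : ℝ, 0 ≤ M ∧ ∀ x y : ℝ, x ∈ Set.Ico 0 (2 * Real.pi) → ∀ m : ZMod k,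
      ‖coherentXi k x y m‖ ≤ M := by
  have hk : (0 : ℝ) < k := by exact_mod_cast Nat.pos_of_ne_zero (NeZero.ne k)
  have hpi := Real.pi_pos
  set N : ℝ := (2 / k : ℝ) ^ (1 / 4 : ℝ) with hN
  have hN0 : 0 ≤ N := by positivity
  -- The constants come from `k π (w - n)² ≥ k π (n² / 2 - 1)`, valid for `w² ≤ 1`.
  set g : ℤ → ℝ := fun n => Real.exp (k * Real.pi) * Real.exp (-(k * Real.pi / 2) * (n : ℝ) ^ 2)
  have hg : Summable g := (summable_exp_neg_mul_sq_int (by positivity)).mul_left _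
  refine ⟨N * ∑' n, g n, mul_nonneg hN0 (tsum_nonneg fun n => by positivity), fun x y hx m => ?_⟩
  have h1 : ‖exp (-(I * k * x * y) / (4 * Real.pi))‖ = 1 := by
    have : (-(I * k * x * y) / (4 * Real.pi) : ℂ) = ((-(k * x * y) / (4 * Real.pi) : ℝ) : ℂ) * I := by
      push_cast; ring
    rw [this, norm_exp_ofReal_mul_I]
  rw [coherentXi, norm_mul, norm_mul, h1, norm_real, Real.norm_of_nonneg hN0, mul_one]
  refine mul_le_mul_of_nonneg_left (tsum_of_norm_bounded hg.hasSum fun n => ?_) hN0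
  set u : ℝ := 2 * Real.pi * m.val / k - 2 * Real.pi * n - x with hu
  have e1 : (2 * Real.pi * (m.val : ℂ) / k - 2 * Real.pi * n - x : ℂ) = (u : ℂ) := by
    rw [hu]; push_cast; rfl
  have e2 : ‖exp (-(k / (4 * Real.pi)) * (u : ℂ) ^ 2)‖ = Real.exp (-(k / (4 * Real.pi)) * u ^ 2) := by
    have : (-(k / (4 * Real.pi)) * (u : ℂ) ^ 2 : ℂ) = ((-(k / (4 * Real.pi)) * u ^ 2 : ℝ) : ℂ) := by
      push_cast; ring
    rw [this, norm_exp_ofReal]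
  have e3 : ‖exp (-(I * k / (2 * Real.pi)) * y * (u : ℂ))‖ = 1 := by
    have : (-(I * k / (2 * Real.pi)) * y * (u : ℂ) : ℂ) =
        ((-(k / (2 * Real.pi)) * y * u : ℝ) : ℂ) * I := by push_cast; ring
    rw [this, norm_exp_ofReal_mul_I]
  rw [e1, norm_mul, e2, e3, mul_one]
  simp only [g]
  rw [← Real.exp_add, Real.exp_le_exp]
  set w : ℝ := m.val / k - x / (2 * Real.pi) with hw
  have hm : (m.val : ℝ) / k < 1 := (div_lt_one hk).2 (by exact_mod_cast ZMod.val_lt m)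
  have hm0 : 0 ≤ (m.val : ℝ) / k := by positivity
  have hx1 : x / (2 * Real.pi) < 1 := (div_lt_one (by positivity)).2 hx.2
  have hx0 : 0 ≤ x / (2 * Real.pi) := div_nonneg hx.1 (by positivity)
  have hw2 : w ^ 2 ≤ 1 := by
    rw [sq_le_one_iff_abs_le_one, abs_le]
    constructor <;> linarith
  have huw : u = 2 * Real.pi * (w - n) := by
    rw [hu, hw]; field_simp; ring
  have e4 : k / (4 * Real.pi) * u ^ 2 = k * Real.pi * (w - n) ^ 2 := by
    rw [huw]; field_simp; ring
  have e5 : (n : ℝ) ^ 2 / 2 - 1 ≤ (w - n) ^ 2 := by nlinarith [sq_nonneg (2 * w - n)]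
  have e6 : k * Real.pi * ((n : ℝ) ^ 2 / 2 - 1) ≤ k * Real.pi * (w - n) ^ 2 := by gcongr
  linarith

/-! ## The pairing -/

section

variable {k : ℕ} [NeZero k] {b : ℂ}

/-- In the bound on the integrand, `x` occurs only in the factor `exp ((2π/k) x · β)`, which comes
out of the integral. -/
lemma exists_norm_partitionFn_le (hb : ‖b‖ = 1) (hre : 0 < b.re) (him : b.im ≠ 0)
    {α β : Fin 15 → ℝ} (h : (α, β) ∈ polytopeNew b) :
    ∃ C : ℝ, 0 ≤ C ∧ ∀ (x : Fin 15 → ℝ) (m : Fin 15 → ZMod k),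
      ‖partitionFn k b β (complexPt x α) m‖ ≤
        C * Real.exp (2 * Real.pi / k * ∑ i, x i * β i) := by
  obtain ⟨-, C, δ, hC, hδ, hbound⟩ := exists_norm_stateIntegrand_le (k := k) hb hre him h
  set J := ∫ y : Fin 15 → ℝ, Real.exp (-δ * ∑ i, |y i|) with hJ
  have hJ0 : 0 ≤ J := integral_nonneg fun y => (Real.exp_pos _).le
  refine ⟨‖(1 / (k : ℂ) ^ 15)‖ * ∑ _n : Fin 15 → ZMod k, C * J, by positivity, fun x m => ?_⟩
  have h1 : ∀ n, ‖∫ y, stateIntegrand k b β (complexPt x α) m n y‖ ≤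
      C * Real.exp (2 * Real.pi / k * ∑ i, x i * β i) * J := by
    intro n
    refine (norm_integral_le_of_norm_le ((integrable_exp_neg_sum_abs hδ).const_mul _)
      (.of_forall fun y => hbound x m n y)).trans (le_of_eq ?_)
    rw [integral_const_mul]
  have h2 := norm_sum_le_of_le Finset.univ fun n _ => h1 n
  rw [partitionFn_eq, norm_mul, mul_assoc]
  refine mul_le_mul_of_nonneg_left (h2.trans (le_of_eq ?_)) (norm_nonneg _)
  rw [Finset.sum_mul]
  exact Finset.sum_congr rfl fun _ _ => by ring

lemma stronglyMeasurable_partitionFn (hb : ‖b‖ = 1) (hre : 0 < b.re) (him : b.im ≠ 0)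
    {α β : Fin 15 → ℝ} (h : (α, β) ∈ polytopeNew b) (μann : Fin 10 → ℝ) (m : Fin 15 → ZMod k) :
    StronglyMeasurable fun μ : Fin 5 → ℝ =>
      partitionFn k b β (complexPt (Fin.append μann μ) α) m := by
  obtain ⟨hc, -⟩ := exists_norm_stateIntegrand_le (k := k) hb hre him h
  have happ : ∀ i : Fin 15, Continuous fun μ : Fin 5 → ℝ => (Fin.append μann μ : Fin 15 → ℝ) i := by
    intro i
    refine Fin.addCases (m := 10) (n := 5) (fun j => ?_) (fun j => ?_) i
    · simpa only [Fin.append_left] using continuous_const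
    · simpa only [Fin.append_right] using continuous_apply j
  simp only [partitionFn_eq]
  refine StronglyMeasurable.const_mul ?_ _
  refine Finset.stronglyMeasurable_fun_sum _ fun n _ => ?_
  refine StronglyMeasurable.integral_prod_right (f := fun (μ : Fin 5 → ℝ) (x : Fin 15 → ℝ) =>
    stateFn k b (shiftArg b (complexPt (Fin.append μann μ) α)) m n (complexPt x β)) ?_
  refine Continuous.stronglyMeasurable ?_
  have h0 : Continuous fun x => actT (actU (Zprod k b)) (complexPt x β) n := by
    -- For `σ = 0` and `m = 0` the Fourier kernel is `1`, which isolates the remaining factor.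
    have := hc 0 0 n
    simpa [stateFn] using this
  simp only [Function.uncurry_def, stateFn]
  refine Continuous.mul ?_ (h0.comp continuous_snd)
  have h1 : ∀ i, Continuous fun p : (Fin 5 → ℝ) × (Fin 15 → ℝ) =>
      shiftArg b (complexPt (Fin.append μann p.1) α) i * complexPt p.2 β i := by
    intro i
    have := (happ i).comp (continuous_fst (X := Fin 5 → ℝ) (Y := Fin 15 → ℝ))
    have h2 : Continuous fun p : (Fin 5 → ℝ) × (Fin 15 → ℝ) =>
        (((Fin.append μann p.1 : Fin 15 → ℝ) i : ℝ) : ℂ) := continuous_ofReal.comp this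
    unfold shiftArg complexPt
    fun_prop
  fun_prop

/-- The annulus coordinates contribute a fixed constant, and the growth in each sphere coordinate is
absorbed by its coherent state. Among the labels, `z` enters only through the centre `d`; `D` is
chosen before all labels. -/
lemma exists_norm_pairingIntegrand_le (hb : ‖b‖ = 1) (hre : 0 < b.re) (him : b.im ≠ 0)
    {α β : Fin 15 → ℝ} (h : (α, β) ∈ polytopeNew b) (μann : Fin 10 → ℝ)
    (mann : Fin 10 → ZMod k) :
    ∃ D : ℝ, 0 ≤ D ∧ ∀ (z : Fin 5 → ℂ) (x y : Fin 5 → ℝ), ∃ d : Fin 5 → ℝ,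
      ∀ (m : Fin 5 → ZMod k) (μ : Fin 5 → ℝ),
        ‖pairingIntegrand k b α β μann mann z x y m μ‖ ≤
          D * (∏ a, ‖coherentXi k (x a) (y a) (m a)‖) *
            ∏ a, Real.exp (-(Real.pi / k) * ((μ - d) a) ^ 2) := by
  obtain ⟨C, hC, hbound⟩ := exists_norm_partitionFn_le (k := k) hb hre him h
  set N : ℝ := (2 / k : ℝ) ^ (1 / 4 : ℝ) with hN
  have hN0 : 0 ≤ N := by positivity
  refine ⟨C * Real.exp (2 * Real.pi / k * ∑ i : Fin 10, μann i * β (Fin.castAdd 5 i)) *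
    ∏ a, (N * Real.exp (Real.pi / k * β (sphereIdx a) ^ 2)), by positivity, fun z x y =>
    ⟨fun a => k / (Real.pi * √2) * (z a).re + β (sphereIdx a), fun m μ => ?_⟩⟩
  have h1 := hbound (Fin.append μann μ) (Fin.append mann m)
  have h2 : ∑ i, (Fin.append μann μ : Fin 15 → ℝ) i * β i =
      ∑ i : Fin 10, μann i * β (Fin.castAdd 5 i) + ∑ a : Fin 5, μ a * β (sphereIdx a) := by
    have := Fin.sum_univ_add (a := 10) (b := 5) fun i => (Fin.append μann μ) i * β i
    simp only [Fin.append_left, Fin.append_right] at this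
    exact this
  rw [h2, mul_add, Real.exp_add, Finset.mul_sum (f := fun a : Fin 5 => μ a * β (sphereIdx a)),
    Real.exp_sum] at h1
  rw [pairingIntegrand, norm_mul, coherentProduct, norm_prod]
  simp only [norm_mul, Finset.prod_mul_distrib (f := fun a => ‖coherentPsi k (β (sphereIdx a)) (z a) (μ a)‖)]
  have h3 : (∏ a : Fin 5, Real.exp (2 * Real.pi / k * (μ a * β (sphereIdx a)))) *
      ∏ a, ‖coherentPsi k (β (sphereIdx a)) (z a) (μ a)‖ =
      (∏ a, (N * Real.exp (Real.pi / k * β (sphereIdx a) ^ 2))) *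
        ∏ a, Real.exp (-(Real.pi / k) *
          (μ a - (k / (Real.pi * √2) * (z a).re + β (sphereIdx a))) ^ 2) := by
    rw [← Finset.prod_mul_distrib, ← Finset.prod_mul_distrib]
    exact Finset.prod_congr rfl fun a _ => norm_coherentPsi_mul k _ _ _
  have hP : 0 ≤ (∏ a, ‖coherentPsi k (β (sphereIdx a)) (z a) (μ a)‖) *
      ∏ a, ‖coherentXi k (x a) (y a) (m a)‖ := by positivity
  refine (mul_le_mul_of_nonneg_right h1 hP).trans (le_of_eq ?_)
  simp only [Pi.sub_apply]
  linear_combination (C * Real.exp (2 * Real.pi / k * ∑ i : Fin 10, μann i * β (Fin.castAdd 5 i)) *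
    ∏ a, ‖coherentXi k (x a) (y a) (m a)‖) * h3

lemma integrable_prod_gaussian (n : ℕ) {c : ℝ} (hc : 0 < c) :
    Integrable fun μ : Fin n → ℝ => ∏ a, Real.exp (-c * (μ a) ^ 2) :=
  Integrable.fintype_prod (f := fun _ x => Real.exp (-c * x ^ 2)) fun _ =>
    integrable_exp_neg_mul_sq hc

lemma integrable_pairingIntegrand (hb : ‖b‖ = 1) (hre : 0 < b.re) (him : b.im ≠ 0)
    {α β : Fin 15 → ℝ} (h : (α, β) ∈ polytopeNew b) (μann : Fin 10 → ℝ)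
    (mann : Fin 10 → ZMod k) (z : Fin 5 → ℂ) (x y : Fin 5 → ℝ) (m : Fin 5 → ZMod k) :
    Integrable (pairingIntegrand k b α β μann mann z x y m) := by
  obtain ⟨D, hD, hbound⟩ := exists_norm_pairingIntegrand_le (k := k) hb hre him h μann mann
  obtain ⟨d, hd⟩ := hbound z x y
  have hc : 0 < Real.pi / k := by have := two_pi_div_pos k; linarith [mul_div_assoc 2 Real.pi (k : ℝ)]
  refine (((integrable_prod_gaussian 5 hc).comp_sub_right d).const_mul
    (D * ∏ a, ‖coherentXi k (x a) (y a) (m a)‖)).mono' ?_ (.of_forall fun μ => hd m μ)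
  refine AEStronglyMeasurable.mul
    (stronglyMeasurable_partitionFn hb hre him h μann _).aestronglyMeasurable ?_
  refine Continuous.aestronglyMeasurable ?_
  unfold coherentProduct
  exact continuous_finsetProd _ fun a _ =>
    ((continuous_coherentPsi k _ _).comp (continuous_apply a)).mul continuous_const

/-- Integrating the Gaussian majorant removes its centre `d` by translation invariance, and with it
the dependence on `z`. -/
lemma exists_norm_pairing_le (hb : ‖b‖ = 1) (hre : 0 < b.re) (him : b.im ≠ 0)
    {α β : Fin 15 → ℝ} (h : (α, β) ∈ polytopeNew b) (μann : Fin 10 → ℝ)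
    (mann : Fin 10 → ZMod k) :
    ∃ C : ℝ, ∀ (z : Fin 5 → ℂ) (x y : Fin 5 → ℝ), (∀ a, x a ∈ Set.Ico 0 (2 * Real.pi)) →
      ‖pairing k b α β μann mann z x y‖ ≤ C := by
  obtain ⟨D, hD, hbound⟩ := exists_norm_pairingIntegrand_le (k := k) hb hre him h μann mann
  obtain ⟨M, hM, hxi⟩ := exists_norm_coherentXi_le k
  have hc : 0 < Real.pi / k := by have := two_pi_div_pos k; linarith [mul_div_assoc 2 Real.pi (k : ℝ)]
  set g : (Fin 5 → ℝ) → ℝ := fun μ => ∏ a, Real.exp (-(Real.pi / k) * (μ a) ^ 2) with hg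
  have hgi : Integrable g := integrable_prod_gaussian 5 hc
  refine ⟨∑ _m : Fin 5 → ZMod k, D * M ^ 5 * ∫ μ, g μ, fun z x y hx => ?_⟩
  obtain ⟨d, hd⟩ := hbound z x y
  refine norm_sum_le_of_le _ fun m _ => ?_
  have h1 : ∏ a, ‖coherentXi k (x a) (y a) (m a)‖ ≤ M ^ 5 := by
    refine (Finset.prod_le_prod (fun a _ => norm_nonneg _)
      fun a _ => hxi (x a) (y a) (hx a) (m a)).trans (le_of_eq ?_)
    simp
  refine (norm_integral_le_of_norm_le ((hgi.comp_sub_right d).const_mul (D * M ^ 5))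
    (.of_forall fun μ => (hd m μ).trans ?_)).trans (le_of_eq ?_)
  · have : 0 ≤ g (μ - d) := Finset.prod_nonneg fun a _ => (Real.exp_pos _).le
    exact mul_le_mul_of_nonneg_right (mul_le_mul_of_nonneg_left h1 hD) this
  · rw [integral_const_mul, integral_sub_right_eq_self g d]

end

lemma nonempty_polytopeNew {b : ℂ} (hb : ‖b‖ = 1) (hre : 0 < b.re) : (polytopeNew b).Nonempty := by
  have hQ : 0 < Qb b := by rw [Qb_eq hb]; linarith
  -- Equal angles `Q / 4` with `β = 0` work because their sum `3 Q / 4` lies strictly between `Q /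
  -- 2` and `Q`.
  refine Set.Nonempty.image _ ⟨(fun _ => Qb b / 4, fun _ => 0), fun a => ?_⟩
  refine ⟨fun i => ?_, ?_, fun i => ?_, fun i => ?_, fun i j _ => ?_⟩ <;>
    simp only [Fin.sum_univ_three] <;> linarith

end GammaFive

end

theorem theorem1 (k : ℕ) [NeZero k] (b : ℂ) (hb : ‖b‖ = 1) (hre : 0 < b.re) (him : b.im ≠ 0) :
    (GammaFive.polytopeNew b).Nonempty ∧
    ∀ α β : Fin 15 → ℝ, (α, β) ∈ GammaFive.polytopeNew b →
      -- the state integral converges absolutely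
      (∀ (x : Fin 15 → ℝ) (m n : Fin 15 → ZMod k),
        MeasureTheory.Integrable
          (GammaFive.stateIntegrand k b β (GammaFive.complexPt x α) m n)) ∧
      -- its value does not depend on the contour
      (∀ β' : Fin 15 → ℝ, (α, β') ∈ GammaFive.polytopeNew b →
        ∀ (x : Fin 15 → ℝ) (m : Fin 15 → ZMod k),
          GammaFive.partitionFn k b β' (GammaFive.complexPt x α) m =
            GammaFive.partitionFn k b β (GammaFive.complexPt x α) m) ∧
      -- for fixed annulus data, the pairing converges and is bounded in the coherent labels
      ∀ (μann : Fin 10 → ℝ) (mann : Fin 10 → ZMod k),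
        (∀ (z : Fin 5 → ℂ) (x y : Fin 5 → ℝ) (m : Fin 5 → ZMod k),
          MeasureTheory.Integrable
            (GammaFive.pairingIntegrand k b α β μann mann z x y m)) ∧
        ∃ C : ℝ, ∀ (z : Fin 5 → ℂ) (x y : Fin 5 → ℝ),
          (∀ a, x a ∈ Set.Ico 0 (2 * Real.pi)) → (∀ a, y a ∈ Set.Ico 0 (2 * Real.pi)) →
            ‖GammaFive.pairing k b α β μann mann z x y‖ ≤ C := by
  exact ⟨GammaFive.nonempty_polytopeNew hb hre, fun α β h =>
    ⟨fun x m n => GammaFive.integrable_stateIntegrand hb hre him h x m n,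
      fun β' h' x m => GammaFive.partitionFn_contour_independent hb hre him h h' x m,
      fun μann mann =>
        ⟨fun z x y m => GammaFive.integrable_pairingIntegrand hb hre him h μann mann z x y m,
          (GammaFive.exists_norm_pairing_le hb hre him h μann mann).imp
            fun _ hC z x y hx _ => hC z x y hx⟩⟩⟩
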